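/- A rooted graph is a finite simple graph $G$ together with a set $R\subseteq V(G)$ of roots. It has a rooted $K_{2,t}$ minor if there are pairwise disjoint vertex sets $X_1,X_2,Y_1,\dots,Y_t\subseteq V(G)$, each inducing a (non-empty) connected subgraph of $G$, such that $G$ has an edge between $X_i$ and $Y_j$ for all $i\in\{1,2\}$ and $j\in\{1,\dots,t\}$, and each $Y_j$ contains a root. If $G$ is embedded in the plane, the faces are the connected components of the complement of $G$ in the plane, a vertex is incident to the faces on whose boundary it lies, and a face cover is a collection of faces such that every root is incident to at least one face of the collection. For even $t\ge 6$, let $p=t/2$ and $q=\lfloor t/5\rfloor$. The windmill $W_t$ is the following rooted graph. Start with a cycle $u_1v_1u_2v_2\cdots u_pv_pu_1$ and a vertex $z$ adjacent to every vertex of the cycle. For each $i\in\{1,\dots,p\}$, add three paths $a_{i,1}\cdots a_{i,2q}$, $b_{i,1}\cdots b_{i,2q}$, $c_{i,1}\cdots c_{i,2q}$ with $a_{i,1}=u_i$, $b_{i,1}=v_i$, $c_{i,1}=u_{i+1}$ (where $u_{p+1}=u_1$) and all other vertices new and distinct, the edges $a_{i,j}b_{i,j}$ and $b_{i,j}c_{i,j}$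 for $2\le j\le 2q$, and the edge $a_{i,2q}c_{i,2q}$. The roots are the vertices $b_{i,j}$ with $1\le i\le p$ and $j\in\{1,\dots,2q\}$ odd. **Proposition.** 1. For every even $t\ge 6$, the graph $W_t$ is $3$-connected and planar, and the rooted graph $W_t$ has no rooted $K_{2,t}$ minor. 2. There is a constant $c>0$ such that for every even $t\ge 6$ and every embedding of $W_t$ in the plane, every face cover of $W_t$ has size at least $c\,t^2$. 3. Consequently, let $f:\mathbb{Z}_{\ge1}\to\mathbb{Z}_{\ge0}$ be any function such that, for every $t\ge1$, every $3$-connected rooted graph embedded in the plane without a rooted $K_{2,t}$ minor has a face cover of size at most $f(t)$. Then $f(t)=\Omega(t^2)$; more precisely, there is a constant $c>0$ such that $f(t)\ge c\,t^2$ for all $t\ge 6$. -/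

import Mathlib

/-! ### Connectivity and rooted minors -/

/-- `G` is `k`-connected: it has more than `k` vertices, and deleting fewer than `k` vertices
always leaves a connected graph. -/
def SimpleGraph.IsVertexConnected {V : Type*} (G : SimpleGraph V) (k : ℕ) : Prop :=
  k < Nat.card V ∧ ∀ X : Finset V, X.card < k → (G.induce (X : Set V)ᶜ).Connected

/-- `M` assigns to the vertices of `H` the branch sets of an `H`-model in `G`: each branch set is
connected (in particular non-empty), branch sets of distinct vertices are disjoint, and for every
edge `uv` of `H` some edge of `G` joins the branch sets of `u` and `v`. -/
structure IsGraphModel {W V : Type*} (H : SimpleGraph W) (G : SimpleGraph V)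
    (M : W → Set V) : Prop where
  connected : ∀ w, (G.induce (M w)).Connected
  disjoint : ∀ u v, u ≠ v → Disjoint (M u) (M v)
  edge : ∀ u v, H.Adj u v → ∃ x ∈ M u, ∃ y ∈ M v, G.Adj x y

/-- The rooted graph `(G, R)` has a rooted `K_{2,t}` minor: there is a `K_{2,t}`-model in `G` whose
`t` branch sets on the second side each contain a root. -/
def HasRootedK2Minor {V : Type*} (G : SimpleGraph V) (R : Set V) (t : ℕ) : Prop :=
  ∃ M : Fin 2 ⊕ Fin t → Set V,
    IsGraphModel (completeBipartiteGraph (Fin 2) (Fin t)) G M ∧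
      ∀ j : Fin t, ∃ r ∈ R, r ∈ M (Sum.inr j)

/-! ### Plane graphs, faces and face covers -/

/-- The Euclidean plane. -/
abbrev Plane : Type := EuclideanSpace ℝ (Fin 2)

/-- An embedding of the graph `G` in the plane: the vertices are distinct points, every edge is a
simple arc joining its two ends, an edge contains no vertex other than its ends, and two distinct
edges meet only in common ends. -/
structure PlaneEmbedding {V : Type*} (G : SimpleGraph V) where
  point : V → Plane
  arc : G.edgeSet → Set Plane
  point_injective : Function.Injective point
  isArc : ∀ (u v : V) (h : s(u, v) ∈ G.edgeSet), ∃ γ : Path (point u) (point v),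
    Function.Injective γ ∧ Set.range γ = arc ⟨s(u, v), h⟩
  mem_of_point_mem : ∀ (e : G.edgeSet) (w : V), point w ∈ arc e → w ∈ (e : Sym2 V)
  arc_inter : ∀ e e' : G.edgeSet, e ≠ e' → ∀ x ∈ arc e ∩ arc e',
    ∃ w : V, w ∈ (e : Sym2 V) ∧ w ∈ (e' : Sym2 V) ∧ x = point w

namespace PlaneEmbedding

variable {V : Type*} {G : SimpleGraph V}

/-- The subset of the plane formed by all vertices and edges of the embedded graph. -/
def carrier (E : PlaneEmbedding G) : Set Plane :=
  Set.range E.point ∪ ⋃ e, E.arc e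

/-- The faces of the embedded graph: the connected components of the complement of the graph. -/
def IsFace (E : PlaneEmbedding G) (F : Set Plane) : Prop :=
  ∃ x ∈ E.carrierᶜ, F = connectedComponentIn E.carrierᶜ x

/-- The vertex `v` is incident to the face `F`: it lies on the boundary of `F`. -/
def IsIncident (E : PlaneEmbedding G) (v : V) (F : Set Plane) : Prop :=
  E.point v ∈ frontier F

/-- `C` is a face cover of the plane rooted graph with root set `R`: a collection of faces such that
every root is incident to some face of the collection. -/
def IsFaceCover (E : PlaneEmbedding G) (R : Set V) (C : Finset (Set Plane)) : Prop :=
  (∀ F ∈ C, E.IsFace F) ∧ ∀ r ∈ R, ∃ F ∈ C, E.IsIncident r F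

end PlaneEmbedding

/-! ### The windmill -/

/-- The vertices of the windmill with `p` vanes of length `2 * q`: the centre `z`, the vertices
`u i`, `v i` of the initial cycle, and the further vertices `a i j`, `b i j`, `c i j` with
`2 ≤ j ≤ 2 * q` of the three paths of the `i`-th vane. -/
inductive WindmillVertex (p q : ℕ) : Type
  | z
  | u (i : Fin p)
  | v (i : Fin p)
  | a (i : Fin p) (j : Set.Icc 2 (2 * q))
  | b (i : Fin p) (j : Set.Icc 2 (2 * q))
  | c (i : Fin p) (j : Set.Icc 2 (2 * q))

namespace WindmillVertex

variable {p q : ℕ}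

/-- The `j`-th vertex of the first path of the `i`-th vane, `1 ≤ j ≤ 2 * q`; it starts at `u i`. -/
def pathA (i : Fin p) (j : Set.Icc 1 (2 * q)) : WindmillVertex p q :=
  if h : 2 ≤ (j : ℕ) then a i ⟨j, h, j.2.2⟩ else u i

/-- The `j`-th vertex of the second path of the `i`-th vane, `1 ≤ j ≤ 2 * q`; it starts at `v i`. -/
def pathB (i : Fin p) (j : Set.Icc 1 (2 * q)) : WindmillVertex p q :=
  if h : 2 ≤ (j : ℕ) then b i ⟨j, h, j.2.2⟩ else v i

/-- The `j`-th vertex of the third path of the `i`-th vane, `1 ≤ j ≤ 2 * q`; it starts at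
`u (i + 1)`, with the index `i + 1` computed cyclically. -/
def pathC (i : Fin p) (j : Set.Icc 1 (2 * q)) : WindmillVertex p q :=
  if h : 2 ≤ (j : ℕ) then c i ⟨j, h, j.2.2⟩ else u (finRotate p i)

/-- The edges of the windmill, each listed in one orientation. -/
def Edge (x y : WindmillVertex p q) : Prop :=
  -- the cycle `u_1 v_1 u_2 v_2 ... u_p v_p u_1`
  (∃ i, x = u i ∧ y = v i) ∨ (∃ i, x = v i ∧ y = u (finRotate p i)) ∨
  -- the centre is adjacent to every vertex of the cycle
  (∃ i, x = z ∧ y = u i) ∨ (∃ i, x = z ∧ y = v i) ∨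
  -- the three paths of each vane
  (∃ (i : Fin p) (j k : Set.Icc 1 (2 * q)), (k : ℕ) = j + 1 ∧
    ((x = pathA i j ∧ y = pathA i k) ∨ (x = pathB i j ∧ y = pathB i k) ∨
      (x = pathC i j ∧ y = pathC i k))) ∨
  -- the rungs of each vane
  (∃ (i : Fin p) (j : Set.Icc 1 (2 * q)), 2 ≤ (j : ℕ) ∧
    ((x = pathA i j ∧ y = pathB i j) ∨ (x = pathB i j ∧ y = pathC i j))) ∨
  -- the edge joining the ends of the outer two paths of each vane
  (∃ (i : Fin p) (j : Set.Icc 1 (2 * q)), (j : ℕ) = 2 * q ∧ x = pathA i j ∧ y = pathC i j)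

end WindmillVertex

/-- The windmill of parameter `t`, with `t / 2` vanes of length `2 * ⌊t / 5⌋`. -/
def windmill (t : ℕ) : SimpleGraph (WindmillVertex (t / 2) (t / 5)) :=
  SimpleGraph.fromRel WindmillVertex.Edge

/-- The roots of the windmill of parameter `t`: the vertices `b_{i,j}` with `j` odd. -/
def windmillRoots (t : ℕ) : Set (WindmillVertex (t / 2) (t / 5)) :=
  {x | ∃ (i : Fin (t / 2)) (j : Set.Icc 1 (2 * (t / 5))), Odd (j : ℕ) ∧
    x = WindmillVertex.pathB i j}

/-! Write p = t/2 and q = ⌊t/5⌋, so that 5q ≤ 2p.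

Face covers. The roots b_{i,j} with j odd and 3 ≤ j ≤ 2q - 1 lie on pairwise distinct faces in every
embedding, which forces p(q - 1) faces. If b_{i,m+1} and a root w outside the rows ≥ m of vane i
were on a common face, a curve through that face would complete a drawing of K_{3,3}: one class is
b_{i,m}, b_{i,m+2}, w, the other is a_{i,m}, c_{i,m}, b_{i,m+1}, and the eight edges other than w
b_{i,m+1} are paths of the windmill (`not_isIncident_colB`). That K_{3,3} has no drawing is proved
without the Jordan curve theorem. For two disjoint edges γ, δ the function γ(s) - δ(t) has a
continuous logarithm on the square, which gives one integer equation for each pair of disjoint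
edges; the sum of all of them is contradictory modulo 2 (`not_drawing_K33_complex`).

No rooted minor. Let X, X' be the hubs and Y_j the rooted branch sets. A vane is attached to the
rest of the graph only through its ends u_i, u_{i+1} and the centre z. A hub inside one vane serves
at most q + 3 sets. Otherwise one hub, say X', avoids z. Being connected, X' crosses all but at most
two of the vanes that it touches (`card_touched_not_crossed_le`). A crossed vane holds at most one
Y_j avoiding z, since X can enter it only from z along the second path (`eq_of_crosses`); the at
most two exceptional vanes hold at most q each; a Y_j rooted in an untouched vane and avoiding z
uses up some u_k outside X'. The total is at most p + 2q < 2p = t (`card_le_of_z_notMem`).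

The windmill is 3-connected because every vertex off the rim u_1 v_1 ... u_p v_p has a fan of three
paths to the rim, and rim and centre form a wheel. It is planar by an explicit drawing in polar
coordinates. The lower bound for f follows by testing it on the windmill of parameter t or t - 1. -/

/-! ### Planar drawings of `K_{3,3}` -/

section LogIncrement

open Complex

/-- `d` is the total increment of a continuous logarithm along the nowhere vanishing curve `f`. -/
def IsLogIncrement (f : ℝ → ℂ) (d : ℂ) : Prop :=
  ∃ l : ℝ → ℂ, Continuous l ∧ (∀ t, exp (l t) = f t) ∧ l 1 - l 0 = d

/-- The exponential is a covering map onto the nonzero numbers, and maps from simply connected,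
locally path-connected spaces lift through it. -/
theorem exists_continuous_log {A : Type*} [TopologicalSpace A] [SimplyConnectedSpace A]
    [LocallyPathConnectedSpace A] {f : A → ℂ} (hf : Continuous f) (h0 : ∀ a, f a ≠ 0) :
    ∃ l : A → ℂ, Continuous l ∧ ∀ a, exp (l a) = f a := by
  obtain ⟨a₀⟩ : Nonempty A := inferInstance
  obtain ⟨F, ⟨-, hF⟩, -⟩ := isCoveringMapOn_exp.existsUnique_continuousMap_lifts
    ⟨f, hf⟩ (a₀ := a₀) (exp_log (h0 a₀)) (fun a => h0 a)
  exact ⟨F, F.continuous, fun a => congrFun hF a⟩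

/-- The function l - m - c is continuous with values in 2πiℤ, hence constant. -/
theorem sub_eq_const_of_exp_eq {l m : ℝ → ℂ} (hl : Continuous l) (hm : Continuous m)
    (c : ℂ) (h : ∀ t, exp (l t) = exp (m t + c)) (s t : ℝ) : l s - m s = l t - m t := by
  have key : ∀ u, ∃ n : ℤ, l u - m u - c = n * (2 * Real.pi * I) := fun u => by
    obtain ⟨n, hn⟩ := exp_eq_exp_iff_exists_int.1 (h u)
    exact ⟨n, by rw [hn]; ring⟩
  choose n hn using key
  have hpi : (2 * Real.pi * I : ℂ) ≠ 0 := two_pi_I_ne_zero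
  have hcast : Continuous fun u => ((n u : ℝ) : ℂ) := by
    have : (fun u => ((n u : ℝ) : ℂ)) = fun u => (l u - m u - c) / (2 * Real.pi * I) := by
      funext u
      rw [hn u, mul_div_cancel_right₀ _ hpi]
      push_cast; rfl
    rw [this]
    fun_prop
  have hreal : Continuous fun u => (n u : ℝ) := by
    have := continuous_re.comp hcast
    exact this.congr fun u => by simp
  have hn_cont : Continuous n := Int.isClosedEmbedding_coe_real.isEmbedding.continuous_iff.2 hreal
  have hconst := PreconnectedSpace.constant (f := n) inferInstance hn_cont (x := s) (y := t)
  have h1 := hn s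
  have h2 := hn t
  rw [hconst] at h1
  linear_combination h1 - h2

theorem IsLogIncrement.unique {f : ℝ → ℂ} {d d' : ℂ} (h : IsLogIncrement f d)
    (h' : IsLogIncrement f d') : d = d' := by
  obtain ⟨l, hl, hlf, rfl⟩ := h
  obtain ⟨m, hm, hmf, rfl⟩ := h'
  have := sub_eq_const_of_exp_eq hl hm 0 (fun t => by rw [hlf, add_zero, hmf]) 1 0
  linear_combination this

theorem IsLogIncrement.neg {f : ℝ → ℂ} {d : ℂ} (h : IsLogIncrement f d) :
    IsLogIncrement (fun t => -f t) d := by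
  obtain ⟨l, hl, hlf, rfl⟩ := h
  refine ⟨fun t => l t + Real.pi * I, by fun_prop, fun t => ?_, by ring⟩
  rw [exp_add, hlf, exp_pi_mul_I, mul_neg_one]

/-- Once logarithms of the two end values are fixed, only an integer remains unknown. These integers
are the variables of the final system of equations. -/
theorem exists_isLogIncrement {f : ℝ → ℂ} (hf : Continuous f) (h0 : ∀ t, f t ≠ 0) {a b : ℂ}
    (ha : exp a = f 0) (hb : exp b = f 1) :
    ∃ n : ℤ, IsLogIncrement f (b - a + n * (2 * Real.pi * I)) := by
  obtain ⟨l, hl, hlf⟩ := exists_continuous_log hf h0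
  obtain ⟨n, hn⟩ := exp_eq_exp_iff_exists_int.1 ((hlf 0).trans ha.symm)
  obtain ⟨m, hm⟩ := exp_eq_exp_iff_exists_int.1 ((hlf 1).trans hb.symm)
  refine ⟨m - n, l, hl, hlf, ?_⟩
  rw [hn, hm]; push_cast; ring

/-- The increments of the logarithm of `γ s - δ t` along the boundary of the unit square cancel. -/
theorem isLogIncrement_square {γ δ : ℝ → ℂ} (hγ : Continuous γ) (hδ : Continuous δ)
    (hne : ∀ s t, γ s ≠ δ t) {d₁ d₂ d₃ d₄ : ℂ}
    (h₁ : IsLogIncrement (fun s => γ s - δ 0) d₁) (h₂ : IsLogIncrement (fun t => δ t - γ 1) d₂)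
    (h₃ : IsLogIncrement (fun t => δ t - γ 0) d₃) (h₄ : IsLogIncrement (fun s => γ s - δ 1) d₄) :
    d₁ + d₂ = d₃ + d₄ := by
  obtain ⟨L, hL, hexp⟩ := exists_continuous_log (A := ℝ × ℝ)
    (f := fun p => γ p.1 - δ p.2) (by fun_prop) (fun p => sub_ne_zero.2 (hne _ _))
  have e₁ := h₁.unique ⟨fun s => L (s, 0), by fun_prop, fun s => hexp _, rfl⟩
  have e₂ := h₂.neg.unique
    ⟨fun t => L (1, t), by fun_prop, fun t => (hexp _).trans (neg_sub _ _).symm, rfl⟩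
  have e₃ := h₃.neg.unique
    ⟨fun t => L (0, t), by fun_prop, fun t => (hexp _).trans (neg_sub _ _).symm, rfl⟩
  have e₄ := h₄.unique ⟨fun s => L (s, 1), by fun_prop, fun s => hexp _, rfl⟩
  rw [e₁, e₂, e₃, e₄]; ring

/-- One logarithm is fixed for each difference of vertices. As P b - P a = -(P a - P b), the two
orientations cannot agree; the shift by πi is the source of the parity obstruction. -/
theorem exists_antisymm_log {n : ℕ} {P : Fin n → ℂ} (hP : Function.Injective P) :
    ∃ Λ : Fin n → Fin n → ℂ, (∀ a b, a ≠ b → exp (Λ a b) = P a - P b) ∧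
      ∀ a b, a < b → Λ b a = Λ a b + Real.pi * I := by
  refine ⟨fun a b => if a < b then log (P a - P b) else log (P b - P a) + Real.pi * I,
    fun a b hab => ?_, fun a b hab => ?_⟩
  · rcases lt_or_gt_of_ne hab with h | h
    · simp only [if_pos h]
      rw [exp_log (sub_ne_zero.2 (hP.ne hab))]
    · simp only [if_neg h.not_gt]
      rw [exp_add, exp_log (sub_ne_zero.2 (hP.ne hab.symm)), exp_pi_mul_I]
      ring
  · simp only [if_pos hab, if_neg hab.not_gt]

theorem int_eq_of_mul_two_pi_I {n : ℤ} {c : ℤ}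
    (h : (n : ℂ) * (2 * Real.pi * I) = c * (2 * Real.pi * I)) : n = c := by
  exact_mod_cast mul_right_cancel₀ two_pi_I_ne_zero h

/-- `K_{3,3}` has no drawing in the complex plane in which edges without a common end are
disjoint. -/
theorem not_drawing_K33_complex (P : Fin 6 → ℂ)
    (γ : Fin 3 → Fin 3 → ℝ → ℂ) (hγ : ∀ i j, Continuous (γ i j))
    (h0 : ∀ i j, γ i j 0 = P (Fin.castAdd 3 i)) (h1 : ∀ i j, γ i j 1 = P (Fin.natAdd 3 j))
    (hdis : ∀ i j k l, i ≠ k → j ≠ l → ∀ s t, γ i j s ≠ γ k l t)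
    (hP : Function.Injective P) : False := by
  obtain ⟨Λ, hΛ, hΛs⟩ := exists_antisymm_log hP
  have hx : ∀ i j k, i ≠ k → ∃ n : ℤ, IsLogIncrement (fun t => γ i j t - P (Fin.castAdd 3 k))
      (Λ (Fin.natAdd 3 j) (Fin.castAdd 3 k) - Λ (Fin.castAdd 3 i) (Fin.castAdd 3 k)
        + n * (2 * Real.pi * I)) := fun i j k hik => by
    have hc : Continuous fun t => γ i j t - P (Fin.castAdd 3 k) := (hγ i j).sub continuous_const
    refine exists_isLogIncrement hc (fun t => ?_) ?_ ?_
    -- In `Fin 3` the index j + 1 differs from j, so the vertex is an end of an edge that is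
    -- disjoint from the edge (i, j).
    · rw [sub_ne_zero, ← h0 k (j + 1)]
      exact hdis i j k (j + 1) hik (by fin_cases j <;> decide) t 0
    · rw [h0, hΛ]
      simpa [Fin.ext_iff] using hik
    · rw [h1, hΛ]
      exact fun h => by have := congrArg Fin.val h; simp at this; omega
  have hy : ∀ i j l, j ≠ l → ∃ n : ℤ, IsLogIncrement (fun t => γ i j t - P (Fin.natAdd 3 l))
      (Λ (Fin.natAdd 3 j) (Fin.natAdd 3 l) - Λ (Fin.castAdd 3 i) (Fin.natAdd 3 l)
        + n * (2 * Real.pi * I)) := fun i j l hjl => by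
    have hc : Continuous fun t => γ i j t - P (Fin.natAdd 3 l) := (hγ i j).sub continuous_const
    refine exists_isLogIncrement hc (fun t => ?_) ?_ ?_
    · rw [sub_ne_zero, ← h1 (i + 1) l]
      exact hdis i j (i + 1) l (by fin_cases i <;> decide) hjl t 1
    · rw [h0, hΛ]
      exact fun h => by have := congrArg Fin.val h; simp at this; omega
    · rw [h1, hΛ]
      simpa [Fin.ext_iff] using hjl
  choose! m hm using hx
  choose! n hn using hy
  have sq : ∀ i k j l, i ≠ k → j ≠ l → _ := fun i k j l hik hjl =>
    isLogIncrement_square (hγ i j) (hγ k l) (fun s t => hdis i j k l hik hjl s t)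
      (by simpa only [h0] using hm i j k hik) (by simpa only [h1] using hn k l j hjl.symm)
      (by simpa only [h0] using hm k l i hik.symm) (by simpa only [h1] using hn i j l hjl)
  have key : ∀ i k j l, i < k → j < l → m i j k + n k l j - m k l i - n i j l = -1 := by
    intro i k j l hik hjl
    apply int_eq_of_mul_two_pi_I
    have a1 := hΛs (Fin.castAdd 3 i) (Fin.castAdd 3 k) (by rw [Fin.lt_def]; simpa using hik)
    have a2 := hΛs (Fin.natAdd 3 j) (Fin.natAdd 3 l) (by rw [Fin.lt_def]; simpa using hjl)
    have a3 := hΛs (Fin.castAdd 3 k) (Fin.natAdd 3 j) (by rw [Fin.lt_def]; simp; omega)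
    have a4 := hΛs (Fin.castAdd 3 i) (Fin.natAdd 3 l) (by rw [Fin.lt_def]; simp; omega)
    have := sq i k j l hik.ne hjl.ne
    push_cast
    linear_combination this - a1 - a2 - a3 + a4
  have key' : ∀ i k j l, i < k → l < j → m i j k + n k l j - m k l i - n i j l = 0 := by
    intro i k j l hik hjl
    apply int_eq_of_mul_two_pi_I
    have a1 := hΛs (Fin.castAdd 3 i) (Fin.castAdd 3 k) (by rw [Fin.lt_def]; simpa using hik)
    have a2 := hΛs (Fin.natAdd 3 l) (Fin.natAdd 3 j) (by rw [Fin.lt_def]; simpa using hjl)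
    have a3 := hΛs (Fin.castAdd 3 k) (Fin.natAdd 3 j) (by rw [Fin.lt_def]; simp; omega)
    have a4 := hΛs (Fin.castAdd 3 i) (Fin.natAdd 3 l) (by rw [Fin.lt_def]; simp; omega)
    have := sq i k j l hik.ne hjl.ne'
    push_cast
    linear_combination this - a1 + a2 - a3 + a4
  have f01 : (0 : Fin 3) < 1 := by decide
  have f02 : (0 : Fin 3) < 2 := by decide
  have f12 : (1 : Fin 3) < 2 := by decide
  have all : ∀ i k, i < k → _ := fun i k h =>
    And.intro (key i k 0 1 h f01) <| And.intro (key i k 0 2 h f02) <|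
    And.intro (key i k 1 2 h f12) <| And.intro (key' i k 1 0 h f01) <|
    And.intro (key' i k 2 0 h f02) (key' i k 2 1 h f12)
  have A := all 0 1 f01
  have B := all 0 2 f02
  have C := all 1 2 f12
  -- Each m i j k occurs in exactly two of the eighteen equations (one for each l ≠ j), and likewise
  -- each n i j l. Hence the left sides add up to an even number, whereas the right sides add up to
  -- -9.
  omega

end LogIncrement

/-- `K_{3,3}` has no drawing in the plane in which edges without a common end are disjoint. -/
theorem not_drawing_K33 (x y : Fin 3 → Plane) (γ : ∀ i j, Path (x i) (y j))
    (hdis : ∀ i j k l, i ≠ k → j ≠ l → Disjoint (Set.range (γ i j)) (Set.range (γ k l))) :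
    False := by
  let φ : Plane → ℂ := fun v => Complex.orthonormalBasisOneI.repr.symm v
  have hφ : Continuous φ := Complex.orthonormalBasisOneI.repr.symm.continuous
  have hinj : Function.Injective φ := Complex.orthonormalBasisOneI.repr.symm.injective
  have hne : ∀ i j k l, i ≠ k → j ≠ l → ∀ s t, γ i j s ≠ γ k l t := fun i j k l hik hjl s t h =>
    Set.disjoint_left.1 (hdis i j k l hik hjl) ⟨s, rfl⟩ ⟨t, h.symm⟩
  -- Coinciding vertices would be a common point of two edges that are assumed disjoint.
  have hx : Function.Injective x := fun i k h => by
    by_contra hik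
    exact hne i 0 k 1 hik (by decide) 0 0 (by simpa using h)
  have hy : Function.Injective y := fun j l h => by
    by_contra hjl
    exact hne 0 j 1 l (by decide) hjl 1 1 (by simpa using h)
  have hxy : ∀ i j, x i ≠ y j := fun i j h =>
    hne i (j + 1) (i + 1) j (by fin_cases i <;> decide) (by fin_cases j <;> decide) 0 1
      (by simpa using h)
  refine not_drawing_K33_complex (φ ∘ Fin.append x y) (fun i j t => φ ((γ i j).extend t))
    (fun i j => hφ.comp (γ i j).continuous_extend) (fun i j => by simp)
    (fun i j => ?_)
    (fun i j k l hik hjl s t h => hne i j k l hik hjl _ _ (hinj h)) (hinj.comp ?_)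
  · rw [Path.extend_one, Function.comp, Fin.append_right]
  intro (a : Fin (3 + 3)) (b : Fin (3 + 3))
  refine Fin.addCases (fun i => ?_) (fun i => ?_) a <;>
    refine Fin.addCases (fun j => ?_) (fun j => ?_) b <;> intro h
  · simp only [Fin.append_left] at h; rw [hx h]
  · simp only [Fin.append_left, Fin.append_right] at h; exact (hxy _ _ h).elim
  · simp only [Fin.append_left, Fin.append_right] at h; exact (hxy _ _ h.symm).elim
  · simp only [Fin.append_right] at h; rw [hy h]

/-! ### Reachability inside a vertex set -/

section ReachableIn

variable {V : Type*} {G : SimpleGraph V} {S T : Set V} {x y w : V}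

/-- `y` can be reached from `x` by a walk of `G` all of whose edges have both ends in `S`. -/
def SimpleGraph.ReachableIn (G : SimpleGraph V) (S : Set V) (x y : V) : Prop :=
  Relation.ReflTransGen (fun a b => G.Adj a b ∧ a ∈ S ∧ b ∈ S) x y

/-- The trivial walk has no edges, so x itself need not lie in S. For this reason membership of the
starting point is sometimes a separate hypothesis later on. -/
theorem SimpleGraph.ReachableIn.refl (x : V) : G.ReachableIn S x x :=
  Relation.ReflTransGen.refl (r := fun a b => G.Adj a b ∧ a ∈ S ∧ b ∈ S)

theorem SimpleGraph.ReachableIn.trans (h : G.ReachableIn S x y) (h' : G.ReachableIn S y w) :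
    G.ReachableIn S x w :=
  Relation.ReflTransGen.trans h h'

theorem SimpleGraph.ReachableIn.symm (h : G.ReachableIn S x y) : G.ReachableIn S y x := by
  induction h with
  | refl => exact .refl _
  | tail _ hbc ih => exact Relation.ReflTransGen.head ⟨hbc.1.symm, hbc.2.2, hbc.2.1⟩ ih

theorem SimpleGraph.Adj.reachableIn (h : G.Adj x y) (hx : x ∈ S) (hy : y ∈ S) :
    G.ReachableIn S x y :=
  Relation.ReflTransGen.single ⟨h, hx, hy⟩

theorem SimpleGraph.ReachableIn.mono (h : G.ReachableIn S x y) (hST : S ⊆ T) :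
    G.ReachableIn T x y :=
  Relation.ReflTransGen.mono (r := fun a b => G.Adj a b ∧ a ∈ S ∧ b ∈ S)
    (fun _ _ h => ⟨h.1, hST h.2.1, hST h.2.2⟩) _ _ h

theorem SimpleGraph.reachableIn_chain {f : ℕ → V} {m n : ℕ} (hmn : m ≤ n)
    (hadj : ∀ k, m ≤ k → k < n → G.Adj (f k) (f (k + 1)))
    (hS : ∀ k, m ≤ k → k ≤ n → f k ∈ S) : G.ReachableIn S (f m) (f n) := by
  induction n, hmn using Nat.le_induction with
  | base => exact .refl _
  | succ n hmn ih =>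
    exact (ih (fun k h1 h2 => hadj k h1 (h2.trans n.lt_succ_self))
      (fun k h1 h2 => hS k h1 (h2.trans n.le_succ))).trans
      ((hadj n hmn n.lt_succ_self).reachableIn (hS n hmn n.le_succ) (hS _ (by omega) le_rfl))

theorem SimpleGraph.induce_connected_iff :
    (G.induce S).Connected ↔ S.Nonempty ∧ ∀ x ∈ S, ∀ y ∈ S, G.ReachableIn S x y := by
  constructor
  · intro h
    obtain ⟨s⟩ := h.nonempty
    refine ⟨⟨s, s.2⟩, fun x hx y hy => ?_⟩
    have := (SimpleGraph.reachable_iff_reflTransGen _ _).1 (h.preconnected ⟨x, hx⟩ ⟨y, hy⟩)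
    exact Relation.ReflTransGen.lift (r := (G.induce S).Adj)
      (p := fun a b => G.Adj a b ∧ a ∈ S ∧ b ∈ S) Subtype.val
      (fun a b hab => ⟨hab, a.2, b.2⟩) _ _ this
  · rintro ⟨⟨s, hs⟩, h⟩
    have : Nonempty S := ⟨⟨s, hs⟩⟩
    refine ⟨fun ⟨x, hx⟩ ⟨y, hy⟩ => ?_⟩
    have key : ∀ y, G.ReachableIn S x y → ∀ hy : y ∈ S, (G.induce S).Reachable ⟨x, hx⟩ ⟨y, hy⟩ := by
      intro y hxy
      induction hxy with
      | refl => exact fun _ => .refl _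
      | tail _ hbc ih =>
        exact fun hc => (ih hbc.2.1).trans (SimpleGraph.Adj.reachable (by exact hbc.1))
    exact key y (h x hx y hy) hy

/-- A walk that leaves the set `T` uses an edge that leaves `T`. -/
theorem SimpleGraph.ReachableIn.exists_adj_notMem (h : G.ReachableIn S x y) (hx : x ∈ T)
    (hy : y ∉ T) : ∃ a ∈ S, a ∈ T ∧ ∃ b ∈ S, b ∉ T ∧ G.Adj a b := by
  induction h with
  | refl => exact absurd hx hy
  | @tail b c _ hbc ih =>
    by_cases hb : b ∈ T
    · exact ⟨b, hbc.2.1, hb, c, hbc.2.2, hy, hbc.1⟩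
    · exact ih hb

end ReachableIn

/-! ### The edges of the windmill -/

/-- The windmill with `p` vanes of length `2 * q`. -/
def windmillGraph (p q : ℕ) : SimpleGraph (WindmillVertex p q) :=
  SimpleGraph.fromRel WindmillVertex.Edge

namespace WindmillVertex

variable {p q : ℕ}

/-- The edges of the windmill, in terms of the constructors of `WindmillVertex`. -/
inductive Step : WindmillVertex p q → WindmillVertex p q → Prop
  | uv (i) : Step (u i) (v i)
  | vu (i) : Step (v i) (u (finRotate p i))
  | zu (i) : Step z (u i)
  | zv (i) : Step z (v i)
  | ua (i) (h) : Step (u i) (a i ⟨2, h⟩)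
  | vb (i) (h) : Step (v i) (b i ⟨2, h⟩)
  | uc (i) (h) : Step (u (finRotate p i)) (c i ⟨2, h⟩)
  | aa (i j h h') : Step (a i ⟨j, h⟩) (a i ⟨j + 1, h'⟩)
  | bb (i j h h') : Step (b i ⟨j, h⟩) (b i ⟨j + 1, h'⟩)
  | cc (i j h h') : Step (c i ⟨j, h⟩) (c i ⟨j + 1, h'⟩)
  | ab (i j) : Step (a i j) (b i j)
  | bc (i j) : Step (b i j) (c i j)
  | ac (i) (j : Set.Icc 2 (2 * q)) (h : (j : ℕ) = 2 * q) : Step (a i j) (c i j)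

theorem step_of_edge {x y : WindmillVertex p q} (h : Edge x y) : Step x y := by
  rcases h with ⟨i, rfl, rfl⟩ | ⟨i, rfl, rfl⟩ | ⟨i, rfl, rfl⟩ | ⟨i, rfl, rfl⟩ |
    ⟨i, ⟨j, hj⟩, ⟨k, hk⟩, hjk, h⟩ | ⟨i, ⟨j, hj⟩, h2, h⟩ | ⟨i, ⟨j, hj⟩, h2, rfl, rfl⟩
  · exact .uv i
  · exact .vu i
  · exact .zu i
  · exact .zv i
  · simp only at hjk
    subst hjk
    have h1 := hj.1
    have h3 := hk.2
    have h2 : 2 ≤ j + 1 := by omega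
    simp only [pathA, pathB, pathC, h2, dif_pos] at h
    by_cases h2j : 2 ≤ j
    · simp only [h2j, dif_pos] at h
      rcases h with ⟨rfl, rfl⟩ | ⟨rfl, rfl⟩ | ⟨rfl, rfl⟩
      exacts [.aa .., .bb .., .cc ..]
    · obtain rfl : j = 1 := by omega
      simp only [h2j, dif_neg, not_false_iff] at h
      rcases h with ⟨rfl, rfl⟩ | ⟨rfl, rfl⟩ | ⟨rfl, rfl⟩
      exacts [.ua .., .vb .., .uc ..]
  · simp only at h2
    simp only [pathA, pathB, pathC, h2, dif_pos] at h
    rcases h with ⟨rfl, rfl⟩ | ⟨rfl, rfl⟩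
    exacts [.ab .., .bc ..]
  · simp only at h2
    have : 2 ≤ j := by have := hj.1; omega
    simp only [pathA, pathC, this, dif_pos]
    exact .ac _ _ h2

theorem edge_of_step {x y : WindmillVertex p q} (h : Step x y) : Edge x y := by
  cases h with
  | uv i => exact .inl ⟨i, rfl, rfl⟩
  | vu i => exact .inr <| .inl ⟨i, rfl, rfl⟩
  | zu i => exact .inr <| .inr <| .inl ⟨i, rfl, rfl⟩
  | zv i => exact .inr <| .inr <| .inr <| .inl ⟨i, rfl, rfl⟩
  | ua i h =>
    exact .inr <| .inr <| .inr <| .inr <| .inl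
      ⟨i, ⟨1, le_rfl, by have := h.2; omega⟩, ⟨2, by have := h.2; exact ⟨by omega, this⟩⟩, rfl,
        .inl ⟨by simp [pathA], by simp [pathA]⟩⟩
  | vb i h =>
    exact .inr <| .inr <| .inr <| .inr <| .inl
      ⟨i, ⟨1, le_rfl, by have := h.2; omega⟩, ⟨2, by have := h.2; exact ⟨by omega, this⟩⟩, rfl,
        .inr <| .inl ⟨by simp [pathB], by simp [pathB]⟩⟩
  | uc i h =>
    exact .inr <| .inr <| .inr <| .inr <| .inl
      ⟨i, ⟨1, le_rfl, by have := h.2; omega⟩, ⟨2, by have := h.2; exact ⟨by omega, this⟩⟩, rfl,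
        .inr <| .inr ⟨by simp [pathC], by simp [pathC]⟩⟩
  | aa i j h h' =>
    have := h.1
    have := h'.1
    exact .inr <| .inr <| .inr <| .inr <| .inl
      ⟨i, ⟨j, by omega, h.2⟩, ⟨j + 1, by omega, h'.2⟩, rfl,
        .inl ⟨by simp [pathA, *], by simp [pathA, *]⟩⟩
  | bb i j h h' =>
    have := h.1
    have := h'.1
    exact .inr <| .inr <| .inr <| .inr <| .inl
      ⟨i, ⟨j, by omega, h.2⟩, ⟨j + 1, by omega, h'.2⟩, rfl,
        .inr <| .inl ⟨by simp [pathB, *], by simp [pathB, *]⟩⟩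
  | cc i j h h' =>
    have := h.1
    have := h'.1
    exact .inr <| .inr <| .inr <| .inr <| .inl
      ⟨i, ⟨j, by omega, h.2⟩, ⟨j + 1, by omega, h'.2⟩, rfl,
        .inr <| .inr ⟨by simp [pathC, *], by simp [pathC, *]⟩⟩
  | ab i j =>
    have := j.2.1
    exact .inr <| .inr <| .inr <| .inr <| .inr <| .inl
      ⟨i, ⟨j, by omega, j.2.2⟩, this, .inl ⟨by simp [pathA, *], by simp [pathB, *]⟩⟩
  | bc i j =>
    have := j.2.1
    exact .inr <| .inr <| .inr <| .inr <| .inr <| .inl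
      ⟨i, ⟨j, by omega, j.2.2⟩, this, .inr ⟨by simp [pathB, *], by simp [pathC, *]⟩⟩
  | ac i j h =>
    have := j.2.1
    exact .inr <| .inr <| .inr <| .inr <| .inr <| .inr
      ⟨i, ⟨j, by omega, j.2.2⟩, h, by simp only [pathA, this, dif_pos],
        by simp only [pathC, this, dif_pos]⟩

theorem Step.ne {x y : WindmillVertex p q} (h : Step x y) : x ≠ y := by
  cases h <;> simp

theorem adj_iff {x y : WindmillVertex p q} :
    (windmillGraph p q).Adj x y ↔ Step x y ∨ Step y x := by
  rw [windmillGraph, SimpleGraph.fromRel_adj]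
  constructor
  · rintro ⟨-, h | h⟩
    exacts [.inl (step_of_edge h), .inr (step_of_edge h)]
  · rintro (h | h)
    exacts [⟨h.ne, .inl (edge_of_step h)⟩, ⟨h.ne.symm, .inr (edge_of_step h)⟩]

theorem Step.adj {x y : WindmillVertex p q} (h : Step x y) : (windmillGraph p q).Adj x y :=
  adj_iff.2 (.inl h)

/-- To prove a statement about all pairs of adjacent vertices it suffices to prove it, for each
`Step`, in both orientations. -/
theorem adj_induction {P : WindmillVertex p q → WindmillVertex p q → Prop}
    (h : ∀ x y, Step x y → P x y ∧ P y x) {x y : WindmillVertex p q}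
    (hxy : (windmillGraph p q).Adj x y) : P x y := by
  rcases adj_iff.1 hxy with hs | hs
  exacts [(h _ _ hs).1, (h _ _ hs).2]

/-- The `j`-th vertex of the first path of a vane. -/
def colA (i : Fin p) (j : ℕ) : WindmillVertex p q :=
  if h : j ∈ Set.Icc 2 (2 * q) then a i ⟨j, h⟩ else u i

/-- The `j`-th vertex of the second path of a vane. -/
def colB (i : Fin p) (j : ℕ) : WindmillVertex p q :=
  if h : j ∈ Set.Icc 2 (2 * q) then b i ⟨j, h⟩ else v i

/-- The `j`-th vertex of the third path of a vane. -/
def colC (i : Fin p) (j : ℕ) : WindmillVertex p q :=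
  if h : j ∈ Set.Icc 2 (2 * q) then c i ⟨j, h⟩ else u (finRotate p i)

theorem pathB_eq (i : Fin p) (j : Set.Icc 1 (2 * q)) : pathB i j = colB i j := by
  have := j.2.2
  simp [pathB, colB, this]

theorem colA_of_mem {i : Fin p} {j : ℕ} (h : j ∈ Set.Icc 2 (2 * q)) : colA i j = a i ⟨j, h⟩ :=
  dif_pos h

theorem colB_of_mem {i : Fin p} {j : ℕ} (h : j ∈ Set.Icc 2 (2 * q)) : colB i j = b i ⟨j, h⟩ :=
  dif_pos h

theorem colC_of_mem {i : Fin p} {j : ℕ} (h : j ∈ Set.Icc 2 (2 * q)) : colC i j = c i ⟨j, h⟩ :=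
  dif_pos h

/-- Indices outside 2, ..., 2q default to the first vertex of the path; the only such index that
matters is 1. -/
theorem colA_one (i : Fin p) : (colA i 1 : WindmillVertex p q) = u i :=
  dif_neg fun h => by simpa using h.1

theorem colB_one (i : Fin p) : (colB i 1 : WindmillVertex p q) = v i :=
  dif_neg fun h => by simpa using h.1

theorem colC_one (i : Fin p) : (colC i 1 : WindmillVertex p q) = u (finRotate p i) :=
  dif_neg fun h => by simpa using h.1

theorem adj_colA (i : Fin p) {j : ℕ} (h1 : 1 ≤ j) (h2 : j + 1 ≤ 2 * q) :
    (windmillGraph p q).Adj (colA i j) (colA i (j + 1)) := by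
  rw [colA_of_mem (j := j + 1) ⟨by omega, h2⟩]
  rcases h1.eq_or_lt with rfl | h1
  · rw [colA_one]; exact (Step.ua i _).adj
  · rw [colA_of_mem (j := j) ⟨h1, by omega⟩]; exact (Step.aa ..).adj

theorem adj_colB (i : Fin p) {j : ℕ} (h1 : 1 ≤ j) (h2 : j + 1 ≤ 2 * q) :
    (windmillGraph p q).Adj (colB i j) (colB i (j + 1)) := by
  rw [colB_of_mem (j := j + 1) ⟨by omega, h2⟩]
  rcases h1.eq_or_lt with rfl | h1
  · rw [colB_one]; exact (Step.vb i _).adj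
  · rw [colB_of_mem (j := j) ⟨h1, by omega⟩]; exact (Step.bb ..).adj

theorem adj_colC (i : Fin p) {j : ℕ} (h1 : 1 ≤ j) (h2 : j + 1 ≤ 2 * q) :
    (windmillGraph p q).Adj (colC i j) (colC i (j + 1)) := by
  rw [colC_of_mem (j := j + 1) ⟨by omega, h2⟩]
  rcases h1.eq_or_lt with rfl | h1
  · rw [colC_one]; exact (Step.uc i _).adj
  · rw [colC_of_mem (j := j) ⟨h1, by omega⟩]; exact (Step.cc ..).adj

theorem adj_colA_colB (i : Fin p) {j : ℕ} (h : j ∈ Set.Icc 2 (2 * q)) :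
    (windmillGraph p q).Adj (colA i j) (colB i j) := by
  rw [colA_of_mem h, colB_of_mem h]; exact (Step.ab ..).adj

theorem adj_colB_colC (i : Fin p) {j : ℕ} (h : j ∈ Set.Icc 2 (2 * q)) :
    (windmillGraph p q).Adj (colB i j) (colC i j) := by
  rw [colB_of_mem h, colC_of_mem h]; exact (Step.bc ..).adj

theorem adj_colA_colC (i : Fin p) (hq : 1 ≤ q) :
    (windmillGraph p q).Adj (colA i (2 * q)) (colC i (2 * q)) := by
  have h : 2 * q ∈ Set.Icc 2 (2 * q) := ⟨by omega, le_rfl⟩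
  rw [colA_of_mem h, colC_of_mem h]; exact (Step.ac _ _ rfl).adj

instance : Finite (WindmillVertex p q) := by
  refine Finite.of_injective (β := Fin 6 × WithBot (Fin p) × WithBot (Set.Icc 2 (2 * q)))
    (fun x => match x with
      | z => (0, ⊥, ⊥)
      | u i => (1, i, ⊥)
      | v i => (2, i, ⊥)
      | a i j => (3, i, j)
      | b i j => (4, i, j)
      | c i j => (5, i, j)) ?_
  intro x y
  cases x <;> cases y <;> simp

end WindmillVertex

/-! ### Faces of a plane graph and rooted vertices -/

namespace PlaneEmbedding

variable {V : Type*} {G : SimpleGraph V} (E : PlaneEmbedding G) {S T : Set V}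

/-- The part of the embedded graph formed by the vertices in `S` and the edges inside `S`. -/
def carrierOn (S : Set V) : Set Plane :=
  E.point '' S ∪ ⋃ e : G.edgeSet, ⋃ _ : ∀ w ∈ (e : Sym2 V), w ∈ S, E.arc e

theorem carrierOn_subset : E.carrierOn S ⊆ E.carrier := by
  rintro x (⟨v, -, rfl⟩ | hx)
  · exact .inl ⟨v, rfl⟩
  · simp only [Set.mem_iUnion] at hx
    obtain ⟨e, -, he⟩ := hx
    exact .inr (Set.mem_iUnion.2 ⟨e, he⟩)

theorem carrierOn_mono (h : S ⊆ T) : E.carrierOn S ⊆ E.carrierOn T := by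
  rintro x (⟨v, hv, rfl⟩ | hx)
  · exact .inl ⟨v, h hv, rfl⟩
  · simp only [Set.mem_iUnion] at hx
    obtain ⟨e, hS, he⟩ := hx
    exact .inr (Set.mem_iUnion₂.2 ⟨e, fun w hw => h (hS w hw), he⟩)

theorem point_mem_carrierOn_iff {v : V} : E.point v ∈ E.carrierOn S ↔ v ∈ S := by
  constructor
  · rintro (⟨w, hw, h⟩ | h)
    · rwa [← E.point_injective h]
    · simp only [Set.mem_iUnion] at h
      obtain ⟨e, hS, he⟩ := h
      exact hS v (E.mem_of_point_mem e v he)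
  · exact fun hv => .inl ⟨v, hv, rfl⟩

/-- A common point would be a common vertex, or lie on two edges; distinct edges meet only in a
common end, which would belong to both S and T. -/
theorem disjoint_carrierOn (h : Disjoint S T) : Disjoint (E.carrierOn S) (E.carrierOn T) := by
  rw [Set.disjoint_left] at h ⊢
  rintro x (⟨v, hv, rfl⟩ | hx) hx'
  · exact h hv (E.point_mem_carrierOn_iff.1 hx')
  · rcases hx' with ⟨w, hw, rfl⟩ | hx'
    · exact h (E.point_mem_carrierOn_iff.1 (.inr hx)) hw
    · simp only [Set.mem_iUnion] at hx hx'
      obtain ⟨e, hS, he⟩ := hx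
      obtain ⟨e', hT, he'⟩ := hx'
      have hne : e ≠ e' := by
        rintro rfl
        obtain ⟨⟨v, w⟩, hvw⟩ := e
        exact h (hS v (Sym2.mem_mk_left v w)) (hT v (Sym2.mem_mk_left v w))
      obtain ⟨w, hw, hw', -⟩ := E.arc_inter e e' hne x ⟨he, he'⟩
      exact h (hS w hw) (hT w hw')

theorem isCompact_arc (e : G.edgeSet) : IsCompact (E.arc e) := by
  obtain ⟨⟨v, w⟩, hvw⟩ := e
  obtain ⟨γ, -, hγ⟩ := E.isArc v w hvw
  change IsCompact (E.arc ⟨s(v, w), hvw⟩)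
  rw [← hγ]
  exact isCompact_range γ.continuous

theorem isClosed_carrierOn [Finite V] : IsClosed (E.carrierOn S) := by
  refine ((S.toFinite.image _).isClosed).union (isClosed_iUnion_of_finite fun e => ?_)
  exact isClosed_iUnion_of_finite fun _ => (E.isCompact_arc e).isClosed

theorem joinedIn_of_reachableIn {v w : V} (h : G.ReachableIn S v w) (hv : v ∈ S) :
    JoinedIn (E.carrierOn S) (E.point v) (E.point w) := by
  induction h with
  | refl => exact JoinedIn.refl (.inl ⟨v, hv, rfl⟩)
  | @tail x y _ hxy ih =>
    refine ih.trans ?_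
    obtain ⟨γ, -, hγ⟩ := E.isArc x y hxy.1
    refine ⟨γ, fun t => .inr (Set.mem_iUnion₂.2 ⟨⟨s(x, y), hxy.1⟩, ?_, ?_⟩)⟩
    · intro w hw
      rcases Sym2.mem_iff.1 hw with rfl | rfl
      exacts [hxy.2.1, hxy.2.2]
    · rw [← hγ]; exact ⟨t, rfl⟩

/-- Two vertices outside `S` on the boundary of the same face are joined by a curve that avoids the
part of the embedded graph formed by `S`. -/
theorem joinedIn_of_isIncident [Finite V] {F : Set Plane} (hF : E.IsFace F) {v w : V}
    (hv : E.IsIncident v F) (hw : E.IsIncident w F) (hvS : v ∉ S) (hwS : w ∉ S) :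
    JoinedIn (E.carrierOn S)ᶜ (E.point v) (E.point w) := by
  obtain ⟨x, hx, rfl⟩ := hF
  set F := connectedComponentIn E.carrierᶜ x
  have hFS : F ⊆ (E.carrierOn S)ᶜ :=
    (connectedComponentIn_subset _ _).trans (Set.compl_subset_compl.2 E.carrierOn_subset)
  set F' := F ∪ {E.point v, E.point w}
  -- A set between a connected set and its closure is connected. Enlarged by the two boundary
  -- points, the face still avoids the closed set `carrierOn S`, and components of the open
  -- complement are path-connected.
  have hF' : IsPreconnected F' := by
    refine isPreconnected_connectedComponentIn.subset_closure Set.subset_union_left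
      (Set.union_subset subset_closure ?_)
    rintro y (rfl | rfl)
    exacts [frontier_subset_closure hv, frontier_subset_closure hw]
  have hsub : F' ⊆ (E.carrierOn S)ᶜ := by
    refine Set.union_subset hFS ?_
    rintro y (rfl | rfl)
    exacts [fun h => hvS (E.point_mem_carrierOn_iff.1 h),
      fun h => hwS (E.point_mem_carrierOn_iff.1 h)]
  have hv' : E.point v ∈ F' := .inr (.inl rfl)
  have hw' : E.point w ∈ F' := .inr (.inr rfl)
  have hopen : IsOpen (E.carrierOn S)ᶜ := E.isClosed_carrierOn.isOpen_compl
  have hconn : IsConnected (connectedComponentIn (E.carrierOn S)ᶜ (E.point v)) :=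
    isConnected_connectedComponentIn_iff.2 (hsub hv')
  have hpath := hopen.connectedComponentIn.isConnected_iff_isPathConnected.1 hconn
  exact (hpath.joinedIn _ (mem_connectedComponentIn (hsub hv')) _
    (hF'.subset_connectedComponentIn hv' hsub hw')).mono (connectedComponentIn_subset _ _)

end PlaneEmbedding

/-- Eight edges of a K_{3,3} are realised by walks in the graph, and the ninth, from x 2 to y 2,
would run through the face F. Only edges without a common end have to be disjoint, so sets S i j
sharing an index may overlap. -/
theorem PlaneEmbedding.not_isIncident_of_K33 {V : Type*} [Finite V] {G : SimpleGraph V}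
    (E : PlaneEmbedding G) (x y : Fin 3 → V) (S : Fin 3 → Fin 3 → Set V)
    (hmem : ∀ i j, i ≠ 2 ∨ j ≠ 2 → x i ∈ S i j)
    (hreach : ∀ i j, i ≠ 2 ∨ j ≠ 2 → G.ReachableIn (S i j) (x i) (y j))
    (hdis : ∀ i j k l, i ≠ 2 ∨ j ≠ 2 → k ≠ 2 ∨ l ≠ 2 → i ≠ k → j ≠ l →
      Disjoint (S i j) (S k l))
    (hx : ∀ i j, i ≠ 2 → j ≠ 2 → x 2 ∉ S i j) (hy : ∀ i j, i ≠ 2 → j ≠ 2 → y 2 ∉ S i j)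
    {F : Set Plane} (hF : E.IsFace F) (hxF : E.IsIncident (x 2) F) (hyF : E.IsIncident (y 2) F) :
    False := by
  -- R collects the four edges that share no end with the ninth one; these are the only ones that
  -- the curve through F has to avoid.
  set R : Set V := ⋃ i, ⋃ j, ⋃ _ : i ≠ 2 ∧ j ≠ 2, S i j with hR
  have hSR : ∀ i j, i ≠ 2 → j ≠ 2 → S i j ⊆ R := fun i j hi hj w hw => by
    simp only [hR, Set.mem_iUnion]
    exact ⟨i, j, ⟨hi, hj⟩, hw⟩
  have hR' : ∀ w, (∀ i j, i ≠ 2 → j ≠ 2 → w ∉ S i j) → w ∉ R := fun w hw h => by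
    simp only [hR, Set.mem_iUnion] at h
    obtain ⟨i, j, ⟨hi, hj⟩, h⟩ := h
    exact hw i j hi hj h
  let T : Fin 3 → Fin 3 → Set Plane := fun i j =>
    if i ≠ 2 ∨ j ≠ 2 then E.carrierOn (S i j) else (E.carrierOn R)ᶜ
  have hT : ∀ i j, JoinedIn (T i j) (E.point (x i)) (E.point (y j)) := fun i j => by
    by_cases h : i ≠ 2 ∨ j ≠ 2
    · simp only [T, if_pos h]
      exact E.joinedIn_of_reachableIn (hreach i j h) (hmem i j h)
    · simp only [T, if_neg h]
      push Not at h
      obtain ⟨rfl, rfl⟩ := h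
      exact E.joinedIn_of_isIncident hF hxF hyF (hR' _ hx) (hR' _ hy)
  have hdisT : ∀ i j k l, i ≠ k → j ≠ l → Disjoint (T i j) (T k l) := fun i j k l hik hjl => by
    by_cases h : i ≠ 2 ∨ j ≠ 2 <;> by_cases h' : k ≠ 2 ∨ l ≠ 2
    · simp only [T, if_pos h, if_pos h']
      exact E.disjoint_carrierOn (hdis i j k l h h' hik hjl)
    · simp only [T, if_pos h, if_neg h']
      push Not at h'
      obtain ⟨rfl, rfl⟩ := h'
      exact Set.disjoint_compl_right_iff_subset.2 (E.carrierOn_mono (hSR i j hik hjl))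
    · simp only [T, if_neg h, if_pos h']
      push Not at h
      obtain ⟨rfl, rfl⟩ := h
      exact Set.disjoint_compl_left_iff_subset.2 (E.carrierOn_mono (hSR k l hik.symm hjl.symm))
    · push Not at h h'
      exact absurd (h.1.trans h'.1.symm) hik
  refine not_drawing_K33 (fun i => E.point (x i)) (fun j => E.point (y j))
    (fun i j => (hT i j).somePath) (fun i j k l hik hjl => (hdisT i j k l hik hjl).mono ?_ ?_)
  · rintro _ ⟨t, rfl⟩; exact (hT i j).somePath_mem t
  · rintro _ ⟨t, rfl⟩; exact (hT k l).somePath_mem t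

/-! ### Roots of the windmill on distinct faces -/

namespace WindmillVertex

variable {p q : ℕ}

/-- The vertices that do not lie in rows `≥ m` of the `i`-th vane. -/
def below (i : Fin p) (m : ℕ) : Set (WindmillVertex p q) :=
  {x | match x with
    | a i' j | b i' j | c i' j => i' = i → (j : ℕ) < m
    | _ => True}

theorem colB_mem_below {i i' : Fin p} {m j : ℕ} (h : i' = i → j < m) :
    (colB i' j : WindmillVertex p q) ∈ below i m := by
  unfold colB
  split_ifs
  · simpa [below] using h
  · simp [below]

theorem reachableIn_z_of_mem_below {i i' : Fin p} {m j : ℕ} (hj : 1 ≤ j) (hjq : j ≤ 2 * q)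
    (h : i' = i → j < m) : (windmillGraph p q).ReachableIn (below i m) (colB i' j) z := by
  have h1 := SimpleGraph.reachableIn_chain (G := windmillGraph p q) (S := below i m)
    (f := colB i') hj (fun k h1 h2 => adj_colB i' h1 (by omega))
    (fun k h1 h2 => colB_mem_below fun e => by have := h e; omega)
  rw [colB_one] at h1
  exact h1.symm.trans ((Step.zv i').adj.symm.reachableIn (by simp [below]) (by simp [below]))

theorem reachableIn_z_colA {i : Fin p} {m : ℕ} (hm : 2 ≤ m) (hmq : m ≤ 2 * q) :
    (windmillGraph p q).ReachableIn (insert (colA i m) (below i m)) z (colA i m) := by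
  have h1 := SimpleGraph.reachableIn_chain (G := windmillGraph p q)
    (S := insert (colA i m) (below i m))
    (f := colA i) (show 1 ≤ m by omega) (fun k h1 h2 => adj_colA i h1 (by omega))
    (fun k h1 h2 => by
      rcases h2.eq_or_lt with rfl | h2
      · exact .inl rfl
      · right; unfold colA; split_ifs <;> simp [below, h2])
  rw [colA_one] at h1
  exact .trans ((Step.zu i).adj.reachableIn (by simp [below]) (by simp [below])) h1

theorem reachableIn_z_colC {i : Fin p} {m : ℕ} (hm : 2 ≤ m) (hmq : m ≤ 2 * q) :
    (windmillGraph p q).ReachableIn (insert (colC i m) (below i m)) z (colC i m) := by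
  have h1 := SimpleGraph.reachableIn_chain (G := windmillGraph p q)
    (S := insert (colC i m) (below i m))
    (f := colC i) (show 1 ≤ m by omega) (fun k h1 h2 => adj_colC i h1 (by omega))
    (fun k h1 h2 => by
      rcases h2.eq_or_lt with rfl | h2
      · exact .inl rfl
      · right; unfold colC; split_ifs <;> simp [below, h2])
  rw [colC_one] at h1
  exact .trans ((Step.zu _).adj.reachableIn (by simp [below]) (by simp [below])) h1

/-- A vertex in the middle of a vane and a vertex outside the upper part of this vane do not lie on a
common face. -/
theorem not_isIncident_colB (E : PlaneEmbedding (windmillGraph p q)) {i i' : Fin p} {m j : ℕ}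
    (hm : 2 ≤ m) (hmq : m + 2 ≤ 2 * q) (hj : 1 ≤ j) (hjq : j ≤ 2 * q) (h : i' = i → j < m)
    {F : Set Plane} (hF : E.IsFace F) (h1 : E.IsIncident (colB i (m + 1)) F)
    (h2 : E.IsIncident (colB i' j) F) : False := by
  have hm0 : m ∈ Set.Icc 2 (2 * q) := ⟨hm, by omega⟩
  have hm1 : m + 1 ∈ Set.Icc 2 (2 * q) := ⟨by omega, by omega⟩
  have hm2 : m + 2 ∈ Set.Icc 2 (2 * q) := ⟨by omega, hmq⟩
  have hy : (colB i' j : WindmillVertex p q) ∈ below i m := colB_mem_below h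
  have hA0 := adj_colA (q := q) i (j := m) (by omega) (by omega)
  have hA1 := adj_colA (q := q) i (j := m + 1) (by omega) (by omega)
  have hC0 := adj_colC (q := q) i (j := m) (by omega) (by omega)
  have hC1 := adj_colC (q := q) i (j := m + 1) (by omega) (by omega)
  have hB0 := adj_colB (q := q) i (j := m) (by omega) (by omega)
  have hB1 := adj_colB (q := q) i (j := m + 1) (by omega) (by omega)
  have hAB0 := adj_colA_colB (q := q) i hm0
  have hBC0 := adj_colB_colC (q := q) i hm0
  have hAB2 := adj_colA_colB (q := q) i hm2
  have hBC2 := adj_colB_colC (q := q) i hm2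
  have hyz := reachableIn_z_of_mem_below hj hjq h
  have hzA := reachableIn_z_colA (i := i) hm hm0.2
  have hzC := reachableIn_z_colC (i := i) hm hm0.2
  rw [show m + 1 + 1 = m + 2 from rfl] at *
  generalize hyv : colB i' j = y at *
  simp only [colA_of_mem hm0, colA_of_mem hm1, colA_of_mem hm2, colB_of_mem hm0,
    colB_of_mem hm1, colB_of_mem hm2, colC_of_mem hm0, colC_of_mem hm1, colC_of_mem hm2] at *
  have hne : ∀ x, x ∉ below i m → x ≠ y := fun x hx hxy => hx (hxy ▸ hy)
  -- The rungs in rows m and m + 2 and the paths between them give the six edges at b_m and b_{m+2}.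
  -- The vertex y reaches a_m and c_m through z without using any other vertex of rows ≥ m of the
  -- vane. The entry ∅ belongs to the ninth edge and is never used.
  refine E.not_isIncident_of_K33 ![b i ⟨m, hm0⟩, b i ⟨m + 2, hm2⟩, y]
    ![a i ⟨m, hm0⟩, c i ⟨m, hm0⟩, b i ⟨m + 1, hm1⟩]
    ![![{b i ⟨m, hm0⟩, a i ⟨m, hm0⟩}, {b i ⟨m, hm0⟩, c i ⟨m, hm0⟩},
        {b i ⟨m, hm0⟩, b i ⟨m + 1, hm1⟩}],
      ![{b i ⟨m + 2, hm2⟩, a i ⟨m + 2, hm2⟩, a i ⟨m + 1, hm1⟩, a i ⟨m, hm0⟩},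
        {b i ⟨m + 2, hm2⟩, c i ⟨m + 2, hm2⟩, c i ⟨m + 1, hm1⟩, c i ⟨m, hm0⟩},
        {b i ⟨m + 2, hm2⟩, b i ⟨m + 1, hm1⟩}],
      ![insert (a i ⟨m, hm0⟩) (below i m), insert (c i ⟨m, hm0⟩) (below i m), ∅]]
    ?_ ?_ ?_ ?_ ?_ hF h2 h1
  · intro k l hkl
    fin_cases k <;> fin_cases l <;> simp [hy] at hkl ⊢
  · intro k l hkl
    fin_cases k <;> fin_cases l <;> simp at hkl ⊢
    · exact hAB0.symm.reachableIn (by simp) (by simp)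
    · exact hBC0.reachableIn (by simp) (by simp)
    · exact hB0.reachableIn (by simp) (by simp)
    · exact ((hAB2.symm.reachableIn (by simp) (by simp)).trans
        (hA1.symm.reachableIn (by simp) (by simp))).trans
        (hA0.symm.reachableIn (by simp) (by simp))
    · exact ((hBC2.reachableIn (by simp) (by simp)).trans
        (hC1.symm.reachableIn (by simp) (by simp))).trans
        (hC0.symm.reachableIn (by simp) (by simp))
    · exact hB1.symm.reachableIn (by simp) (by simp)
    · exact (hyz.mono (Set.subset_insert _ _)).trans hzA
    · exact (hyz.mono (Set.subset_insert _ _)).trans hzC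
  · intro k l k' l' hkl hkl' hk hl
    fin_cases k <;> fin_cases k' <;> simp at hk <;> fin_cases l <;> fin_cases l' <;>
      simp [below] at hkl hkl' hl ⊢
  · intro k l hk hl
    fin_cases k <;> fin_cases l <;> simp at hk hl ⊢ <;> and_intros <;>
      exact fun e => hne _ (by simp [below]) e.symm
  · intro k l hk hl
    fin_cases k <;> fin_cases l <;> simp at hk hl ⊢

end WindmillVertex

namespace WindmillVertex

variable {p q : ℕ}

/-- Rows 3, 5, ..., 2q - 1 of each vane supply q - 1 roots having rows on both sides with rungs. No
face is incident to two of these roots. -/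
theorem mul_le_card_of_isFaceCover (E : PlaneEmbedding (windmillGraph p q))
    {R : Set (WindmillVertex p q)} (hR : ∀ i j, Odd j → 1 ≤ j → j ≤ 2 * q → colB i j ∈ R)
    {C : Finset (Set Plane)} (hC : E.IsFaceCover R C) : p * (q - 1) ≤ C.card := by
  have hroot : ∀ x : Fin p × Fin (q - 1), ∃ F ∈ C, E.IsIncident (colB x.1 (2 * x.2 + 3)) F :=
    fun x => hC.2 _ (hR _ _ ⟨x.2 + 1, by ring⟩ (by omega) (by omega))
  choose f hfC hf using hroot
  -- The root x plays the middle vertex b_{m+1} with m = 2 x.2 + 2. Within one vane this must be the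
  -- root in the higher row.
  have hlt : ∀ x y, (y.1 = x.1 → y.2 < x.2) → f x ≠ f y := fun x y hxy he => by
    refine not_isIncident_colB E (i := x.1) (i' := y.1) (m := 2 * x.2 + 2) (j := 2 * y.2 + 3)
      (by omega) (by omega) (by omega) (by omega) (fun h => ?_) (hC.1 _ (hfC x)) (hf x)
      (he ▸ hf y)
    have := hxy h
    omega
  have hinj : Function.Injective f := fun x y he => by
    by_contra hne
    by_cases h1 : y.1 = x.1
    · rcases lt_trichotomy x.2 y.2 with h | h | h
      · exact hlt y x (fun _ => h) he.symm
      · exact hne (Prod.ext h1.symm h)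
      · exact hlt x y (fun _ => h) he
    · exact hlt x y (fun h => absurd h h1) he
  have := Finset.card_le_card_of_injOn (s := Finset.univ) (t := C) f (fun x _ => hfC x) hinj.injOn
  simpa using this

end WindmillVertex

theorem colB_mem_windmillRoots {t : ℕ} (i : Fin (t / 2)) (j : ℕ) (hj : Odd j) (h1 : 1 ≤ j)
    (h2 : j ≤ 2 * (t / 5)) : WindmillVertex.colB i j ∈ windmillRoots t :=
  ⟨i, ⟨j, h1, h2⟩, hj, (WindmillVertex.pathB_eq i ⟨j, h1, h2⟩).symm⟩

theorem windmill_faceCover_card {t : ℕ} (ht : 6 ≤ t) (hev : Even t)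
    (E : PlaneEmbedding (windmill t)) (C : Finset (Set Plane))
    (hC : E.IsFaceCover (windmillRoots t) C) : (1 / 100 : ℝ) * (t : ℝ) ^ 2 ≤ (C.card : ℝ) := by
  rcases lt_or_ge t 10 with h | h
  -- For t < 10 there is q = 1 and the general bound is zero, but one face is needed and t²/100 < 1.
  · obtain ⟨F, hF, -⟩ := hC.2 _ (colB_mem_windmillRoots ⟨0, by omega⟩ 1 odd_one le_rfl (by omega))
    have h1 : (1 : ℝ) ≤ C.card := by exact_mod_cast Finset.card_pos.2 ⟨F, hF⟩
    have h2 : (t : ℝ) < 10 := by exact_mod_cast h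
    nlinarith
  · have key : t / 2 * (t / 5 - 1) ≤ C.card :=
      WindmillVertex.mul_le_card_of_isFaceCover (p := t / 2) (q := t / 5) E
        colB_mem_windmillRoots hC
    obtain ⟨k, hk⟩ := hev
    have h2 : t / 2 = k := by omega
    obtain ⟨r, hr⟩ : ∃ r, t / 5 = r + 1 := ⟨t / 5 - 1, by omega⟩
    rw [h2, hr, Nat.add_sub_cancel] at key
    have h3 : (t : ℝ) = 2 * k := by rw [hk]; push_cast; ring
    have h4 : (t : ℝ) ≤ 5 * r + 9 := by exact_mod_cast (by omega : t ≤ 5 * r + 9)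
    have h5 : (10 : ℝ) ≤ t := by exact_mod_cast h
    have h6 : (k : ℝ) * r ≤ C.card := by exact_mod_cast key
    -- With k = t/2 and r ≥ (t - 9)/5 the product is at least t(t - 9)/10, which is at least t²/100
    -- exactly from t = 10 on.
    nlinarith

/-! ### The windmill has no large rooted `K_{2,t}` minor -/

theorem SimpleGraph.exists_adj_of_connected {V : Type*} {G : SimpleGraph V} {S T : Set V}
    (hS : (G.induce S).Connected) {x : V} (hx : x ∈ S) (hxT : x ∈ T) (hST : ¬ S ⊆ T) :
    ∃ a ∈ S, a ∈ T ∧ ∃ b ∈ S, b ∉ T ∧ G.Adj a b := by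
  obtain ⟨y, hy, hyT⟩ := Set.not_subset.1 hST
  exact ((SimpleGraph.induce_connected_iff.1 hS).2 x hx y hy).exists_adj_notMem hxT hyT

theorem finRotate_ne_self {p : ℕ} (hp : 2 ≤ p) (i : Fin p) : finRotate p i ≠ i := by
  obtain ⟨n, rfl⟩ : ∃ n, p = n + 2 := ⟨p - 2, by omega⟩
  intro h
  have h1 := congrArg Fin.val h
  rw [coe_finRotate] at h1
  split_ifs at h1 with h2
  · rw [h2] at h1; simp at h1
  · omega

namespace WindmillVertex

variable {p q : ℕ}

/-- The vertices of the `i`-th vane other than `u i` and `u (i + 1)`. -/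
def vane (i : Fin p) : Set (WindmillVertex p q) :=
  {x | match x with
    | v i' | a i' _ | b i' _ | c i' _ => i' = i
    | _ => False}

/-- The vertices of the `i`-th vane. -/
def closedVane (i : Fin p) : Set (WindmillVertex p q) :=
  {x | x ∈ vane i ∨ x = u i ∨ x = u (finRotate p i)}

theorem eq_of_mem_vane {i i' : Fin p} {x : WindmillVertex p q} (h : x ∈ vane i)
    (h' : x ∈ vane i') : i = i' := by
  cases x <;> simp [vane] at h h' <;> exact h.symm.trans h'

theorem cases_vane (x : WindmillVertex p q) : x = z ∨ (∃ k, x = u k) ∨ ∃ i, x ∈ vane i := by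
  cases x <;> simp [vane]

theorem eq_of_adj_of_mem_vane {i : Fin p} {x y : WindmillVertex p q}
    (h : (windmillGraph p q).Adj x y) (hx : x ∈ vane i) (hy : y ∉ vane i) :
    y = u i ∨ y = u (finRotate p i) ∨ (y = z ∧ x = v i) := by
  revert hx hy
  refine adj_induction (P := fun x y => x ∈ vane i → y ∉ vane i →
    y = u i ∨ y = u (finRotate p i) ∨ (y = z ∧ x = v i)) ?_ h
  intro x y hs
  cases hs <;> simp [vane, -finRotate_apply] <;> grind

theorem exists_vane_of_adj_u {k : Fin p} {y : WindmillVertex p q}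
    (h : (windmillGraph p q).Adj (u k) y) :
    y = z ∨ ∃ i, (k = i ∨ k = finRotate p i) ∧ y ∈ vane i := by
  have key : ∀ x y : WindmillVertex p q, (windmillGraph p q).Adj x y → x = u k →
      y = z ∨ ∃ i, (k = i ∨ k = finRotate p i) ∧ y ∈ vane i := by
    intro x y h
    refine adj_induction (P := fun x y => x = u k →
      y = z ∨ ∃ i, (k = i ∨ k = finRotate p i) ∧ y ∈ vane i) ?_ h
    intro x y hs
    cases hs <;> simp [vane, -finRotate_apply] <;> grind
  exact key _ _ h rfl

theorem u_notMem_vane {i k : Fin p} : (u k : WindmillVertex p q) ∉ vane i := by simp [vane]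

theorem z_notMem_vane {i : Fin p} : (z : WindmillVertex p q) ∉ vane i := by simp [vane]

theorem colB_mem_vane (i : Fin p) (j : ℕ) : (colB i j : WindmillVertex p q) ∈ vane i := by
  unfold colB; split_ifs <;> simp [vane]

/-- A connected set that meets a vane and is not contained in it contains an attachment. -/
theorem exists_attachment {S : Set (WindmillVertex p q)}
    (hS : ((windmillGraph p q).induce S).Connected) {i : Fin p} {x : WindmillVertex p q}
    (hx : x ∈ S) (hxi : x ∈ vane i) (hSi : ¬ S ⊆ vane i) :
    u i ∈ S ∨ u (finRotate p i) ∈ S ∨ z ∈ S := by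
  obtain ⟨a, ha, hai, b, hb, hbi, hab⟩ := SimpleGraph.exists_adj_of_connected hS hx hxi hSi
  rcases eq_of_adj_of_mem_vane hab hai hbi with rfl | rfl | ⟨rfl, -⟩
  exacts [.inl hb, .inr (.inl hb), .inr (.inr hb)]

/-- The vertices of the second path of the `i`-th vane strictly between rows `m` and `k`. -/
def middle (i : Fin p) (m k : ℕ) : Set (WindmillVertex p q) :=
  {x | match x with
    | v i' => i' = i ∧ m < 1 ∧ 1 < k
    | b i' j => i' = i ∧ m < j ∧ (j : ℕ) < k
    | _ => False}

theorem middle_subset_vane {i : Fin p} {m k : ℕ} :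
    (middle i m k : Set (WindmillVertex p q)) ⊆ vane i := by
  intro x; cases x <;> simp +contextual [middle, vane]

theorem exists_eq_colB_of_mem_middle {i : Fin p} {m k : ℕ} {x : WindmillVertex p q}
    (h : x ∈ middle i m k) : ∃ l, m < l ∧ l < k ∧ x = colB i l ∧ ∀ m' < l, x ∈ middle i m' k := by
  cases x with
  | v i' => exact ⟨1, h.2.1, h.2.2, by rw [colB_one, h.1], fun _ hm => ⟨h.1, hm, h.2.2⟩⟩
  | b i' j => exact ⟨j, h.2.1, h.2.2, by rw [colB_of_mem j.2, h.1],
      fun _ hm => ⟨h.1, hm, h.2.2⟩⟩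
  | _ => exact h.elim

/-- The set `X` contains the outer two paths of the vane up to row `k` and, of the second path, the
vertex in row `k` but no vertex in a lower row. -/
structure Encloses (X : Set (WindmillVertex p q)) (i : Fin p) (k : ℕ) : Prop where
  one_le : 1 ≤ k
  left : u i ∈ X
  right : u (finRotate p i) ∈ X
  colA_mem : ∀ j : Set.Icc 2 (2 * q), (j : ℕ) ≤ k → a i j ∈ X
  colC_mem : ∀ j : Set.Icc 2 (2 * q), (j : ℕ) ≤ k → c i j ∈ X
  colB_mem : ∀ j : Set.Icc 2 (2 * q), (j : ℕ) = k → b i j ∈ X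
  v_mem : k = 1 → v i ∈ X

variable {X : Set (WindmillVertex p q)} {i : Fin p} {k m : ℕ}

/-- The sides of the middle segment and its upper end are blocked by X, so the only exit is at the
lower end: the vertex b_m, or the centre if the segment starts at v_i. -/
theorem Encloses.eq_of_adj (hX : Encloses X i k) {x y : WindmillVertex p q}
    (h : (windmillGraph p q).Adj x y) (hx : x ∈ middle i m k) (hy : y ∉ middle i m k)
    (hyX : y ∉ X) : (m = 0 ∧ y = z) ∨ (1 ≤ m ∧ y = colB i m) := by
  obtain ⟨h0, h1, h2, h3, h4, h5, h6⟩ := hX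
  revert hx hy hyX
  refine adj_induction (P := fun x y => x ∈ middle i m k → y ∉ middle i m k →
    y ∉ X → (m = 0 ∧ y = z) ∨ (1 ≤ m ∧ y = colB i m)) ?_ h
  intro x y hs
  cases hs <;> simp [middle, colB, -finRotate_apply] <;> grind

/-- What remains of the vane beyond X and the middle segment is cut off: a connected set avoiding X
that meets it stays in it, and in particular misses z. -/
theorem Encloses.mem_of_adj (hX : Encloses X i k) {x y : WindmillVertex p q}
    (h : (windmillGraph p q).Adj x y) (hx : x ∈ vane i) (hx' : x ∉ middle i 0 k) (hxX : x ∉ X)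
    (hyX : y ∉ X) : y ∈ vane i ∧ y ∉ middle i 0 k := by
  have hy : y ∉ middle i 0 k := fun hy => by
    rcases hX.eq_of_adj h.symm hy hx' hxX with ⟨-, rfl⟩ | ⟨h, -⟩
    · exact z_notMem_vane hx
    · exact absurd h (by omega)
  refine ⟨?_, hy⟩
  by_contra hyi
  rcases eq_of_adj_of_mem_vane h hx hyi with rfl | rfl | ⟨rfl, rfl⟩
  · exact hyX hX.left
  · exact hyX hX.right
  · have := hX.one_le
    have h1 : k ≠ 1 := fun h1 => hxX (hX.v_mem h1)
    exact hx' ⟨rfl, by omega, by omega⟩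

/-- Take k to be the first row in which X meets the second path, or 2q + 1 if there is none. Before
that row X cannot pass from one outer path to the other, so it must climb both of them up to row k.
-/
theorem exists_encloses (hp : 2 ≤ p) (hq : 1 ≤ q) (hu : u i ∈ X) (hu' : u (finRotate p i) ∈ X)
    (h : (windmillGraph p q).ReachableIn (X ∩ closedVane i) (u i) (u (finRotate p i))) :
    ∃ k, Encloses X i k := by
  classical
  have hrot := finRotate_ne_self hp
  have hex : ∃ k, 1 ≤ k ∧ (colB i k ∈ X ∨ 2 * q < k) := ⟨2 * q + 1, by omega, .inr (by omega)⟩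
  obtain ⟨hk1, hk⟩ := Nat.find_spec hex
  have hmin : ∀ m, m < Nat.find hex → 1 ≤ m → colB i m ∉ X := fun m hm h1 h2 =>
    Nat.find_min hex hm ⟨h1, .inl h2⟩
  generalize Nat.find hex = k at *
  clear hex
  have hb : ∀ j : Set.Icc 2 (2 * q), (j : ℕ) < k → b i j ∉ X := fun j hj => by
    rw [← colB_of_mem j.2]; exact hmin j hj (by have := j.2.1; omega)
  have hv : 1 < k → v i ∉ X := fun hj => by
    rw [← colB_one]; exact hmin 1 hj le_rfl
  refine ⟨k, hk1, hu, hu', fun ⟨m, hmI⟩ hm => ?_, fun ⟨m, hmI⟩ hm => ?_, fun j hj => ?_, fun h1 => ?_⟩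
  · by_contra hmX
    -- T is the part of the first path below row m. Within the closed vane it can be left only
    -- through v_i, some b_{i,j} with j < m, or a_{i,m}, and none of these is in X.
    let T : Set (WindmillVertex p q) := {x | match x with
      | u i' => i' = i
      | a i' j => i' = i ∧ (j : ℕ) < m
      | _ => False}
    obtain ⟨x, hxS, hxT, y, hyS, hyT, hxy⟩ := h.exists_adj_notMem (T := T)
      (by simp [T]) (by simpa [T] using hrot i)
    revert hxS hxT hyS hyT
    have hm2 := hmI.1
    have hmq := hmI.2
    simp only at hm
    clear h hmin hk
    refine adj_induction (P := fun x y => x ∈ X ∩ closedVane i → x ∈ T →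
      y ∈ X ∩ closedVane i → y ∉ T → False) ?_ hxy
    intro x y hs
    have hrot := hrot i
    cases hs <;> simp [T, closedVane, vane, -finRotate_apply] <;> grind
  · by_contra hmX
    let T : Set (WindmillVertex p q) := {x | match x with
      | u i' => i' = finRotate p i
      | c i' j => i' = i ∧ (j : ℕ) < m
      | _ => False}
    obtain ⟨x, hxS, hxT, y, hyS, hyT, hxy⟩ := h.symm.exists_adj_notMem (T := T)
      (by simp [T]) (by simpa [T] using (hrot i).symm)
    revert hxS hxT hyS hyT
    have hm2 := hmI.1
    have hmq := hmI.2
    simp only at hm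
    clear h hmin hk
    refine adj_induction (P := fun x y => x ∈ X ∩ closedVane i → x ∈ T →
      y ∈ X ∩ closedVane i → y ∉ T → False) ?_ hxy
    intro x y hs
    have hrot' := hrot (finRotate p i)
    have hrot := hrot i
    have hinj : ∀ i', finRotate p i' = finRotate p i → i' = i := fun i' h =>
      (finRotate p).injective h
    cases hs <;> simp [T, closedVane, vane, -finRotate_apply] <;> grind
  · rcases hk with hk | hk
    · rwa [← hj, colB_of_mem j.2] at hk
    · have := j.2.2; omega
  · rcases hk with hk | hk
    · rwa [h1, colB_one] at hk
    · omega

end WindmillVertex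

/-! ### Vanes crossed by a connected set avoiding the centre -/

namespace WindmillVertex

variable {p q : ℕ} {X : Set (WindmillVertex p q)} {i : Fin p}

/-- The set `X` joins the two ends `u i` and `u (i + 1)` of the `i`-th vane inside this vane. -/
def Crosses (X : Set (WindmillVertex p q)) (i : Fin p) : Prop :=
  u i ∈ X ∧ u (finRotate p i) ∈ X ∧
    (windmillGraph p q).ReachableIn (X ∩ closedVane i) (u i) (u (finRotate p i))

/-- The graph on the vertices `u k` in `X` in which consecutive ones are adjacent if `X` crosses the
vane between them. -/
def crossGraph (X : Set (WindmillVertex p q)) : SimpleGraph {k : Fin p // u k ∈ X} :=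
  SimpleGraph.fromRel fun k l => Crosses X k ∧ (l : Fin p) = finRotate p k

theorem crossGraph_reachable {k l : Fin p} (hk : u k ∈ X) (hl : u l ∈ X)
    (hki : k = i ∨ k = finRotate p i) (hli : l = i ∨ l = finRotate p i)
    (h : (windmillGraph p q).ReachableIn (X ∩ closedVane i) (u k) (u l)) :
    (crossGraph X).Reachable ⟨k, hk⟩ ⟨l, hl⟩ := by
  by_cases hkl : k = l
  · subst hkl; exact .refl _
  refine SimpleGraph.Adj.reachable ?_
  rw [crossGraph, SimpleGraph.fromRel_adj]
  refine ⟨fun h => hkl (congrArg Subtype.val h), ?_⟩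
  rcases hki with rfl | rfl <;> rcases hli with rfl | rfl
  · exact absurd rfl hkl
  · exact .inl ⟨⟨hk, hl, h⟩, rfl⟩
  · exact .inr ⟨⟨hl, hk, h.symm⟩, rfl⟩
  · exact absurd rfl hkl

/-- Follow a walk inside X and remember the last vertex u_k from which it has stayed in one closed
vane. As z is not available, the walk changes vanes only at the vertices u_m, and each passage
between two distinct such vertices is a crossing. -/
theorem crossGraph_preconnected (hX : ((windmillGraph p q).induce X).Connected) (hz : z ∉ X) :
    (crossGraph X).Preconnected := by
  rintro ⟨k₀, hk₀⟩ ⟨l, hl⟩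
  have key : ∀ x, (windmillGraph p q).ReachableIn X (u k₀) x →
      ∃ (k : Fin p) (hk : u k ∈ X) (i : Fin p), (k = i ∨ k = finRotate p i) ∧ x ∈ closedVane i ∧
        (windmillGraph p q).ReachableIn (X ∩ closedVane i) (u k) x ∧
        (crossGraph X).Reachable ⟨k₀, hk₀⟩ ⟨k, hk⟩ := by
    intro x hx
    induction hx with
    | refl => exact ⟨k₀, hk₀, k₀, .inl rfl, .inr (.inl rfl), .refl _, .refl _⟩
    | @tail x y _ hxy ih =>
      obtain ⟨hadj, hxX, hyX⟩ := hxy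
      obtain ⟨k, hk, i, hki, hxi, hkx, hreach⟩ := ih
      by_cases hyi : y ∈ closedVane i
      · exact ⟨k, hk, i, hki, hyi, hkx.trans (hadj.reachableIn ⟨hxX, hxi⟩ ⟨hyX, hyi⟩), hreach⟩
      have hyz : y ≠ z := fun h => hz (h ▸ hyX)
      obtain ⟨m, rfl, hmi⟩ : ∃ m, x = u m ∧ (m = i ∨ m = finRotate p i) := by
        rcases hxi with hxi | rfl | rfl
        · rcases eq_of_adj_of_mem_vane hadj hxi (fun h => hyi (.inl h)) with h | h | h
          exacts [(hyi (.inr (.inl h))).elim, (hyi (.inr (.inr h))).elim, (hyz h.1).elim]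
        · exact ⟨i, rfl, .inl rfl⟩
        · exact ⟨_, rfl, .inr rfl⟩
      rcases exists_vane_of_adj_u hadj with h | ⟨i', hmi', hyi'⟩
      · exact (hyz h).elim
      · have hm : u m ∈ closedVane (q := q) i' := by
          rcases hmi' with rfl | rfl
          exacts [.inr (.inl rfl), .inr (.inr rfl)]
        exact ⟨m, hxX, i', hmi', .inl hyi', hadj.reachableIn ⟨hxX, hm⟩ ⟨hyX, .inl hyi'⟩,
          hreach.trans (crossGraph_reachable hk hxX hki hmi hkx)⟩
  obtain ⟨k, hk, i, hki, hli, hkl, hreach⟩ :=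
    key (u l) ((SimpleGraph.induce_connected_iff.1 hX).2 _ hk₀ _ hl)
  refine hreach.trans (crossGraph_reachable hk hl hki ?_ hkl)
  rcases hli with h | h | h
  · exact (u_notMem_vane h).elim
  · exact .inl (by simpa using h)
  · exact .inr (by simpa [-finRotate_apply] using h)

-- A connected graph on n vertices has at least n - 1 edges, and every edge of `crossGraph X` comes
-- from a crossed vane.
open Classical in
theorem card_u_le_card_crosses_add_one (hX : ((windmillGraph p q).induce X).Connected)
    (hz : z ∉ X) :
    (Finset.univ.filter fun k : Fin p => u k ∈ X).card ≤
      (Finset.univ.filter fun k : Fin p => Crosses X k).card + 1 := by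
  rcases isEmpty_or_nonempty {k : Fin p // u k ∈ X} with h | h
  · have : (Finset.univ.filter fun k : Fin p => u k ∈ X) = ∅ := by
      ext k; simpa using fun hk => h.false ⟨k, hk⟩
    simp [this]
  have hconn : (crossGraph X).Connected := ⟨crossGraph_preconnected hX hz⟩
  have h1 := hconn.card_vert_le_card_edgeSet_add_one
  have h2 : Nat.card (crossGraph X).edgeSet ≤ Nat.card {k : Fin p // Crosses X k} := by
    -- Edges are mapped to vanes and not conversely, since for p = 2 two crossed vanes may yield the
    -- same edge.
    have hf : ∀ e : (crossGraph X).edgeSet, ∃ k : {k : Fin p // Crosses X k},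
        (e : Sym2 {k : Fin p // u k ∈ X}) =
          s(⟨k, k.2.1⟩, ⟨finRotate p k, k.2.2.1⟩) := by
      rintro ⟨⟨k, l⟩, hkl⟩
      have hkl' : (crossGraph X).Adj k l := hkl
      rw [crossGraph, SimpleGraph.fromRel_adj] at hkl'
      rcases hkl'.2 with h | h
      · refine ⟨⟨k, h.1⟩, ?_⟩
        have : l = ⟨finRotate p k, h.1.2.1⟩ := Subtype.ext h.2
        rw [← this]
      · refine ⟨⟨l, h.1⟩, ?_⟩
        have : k = ⟨finRotate p l, h.1.2.1⟩ := Subtype.ext h.2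
        rw [← this]; exact Sym2.eq_swap
    choose f hf using hf
    refine Nat.card_le_card_of_injective f fun e e' hee' => Subtype.ext ?_
    rw [hf e, hf e', hee']
  rw [Nat.card_eq_fintype_card, Fintype.card_subtype] at h1
  rw [Nat.card_eq_fintype_card (α := {k : Fin p // Crosses X k}), Fintype.card_subtype] at h2
  omega

open Classical in
/-- At most two vanes have an end in `X` and are not crossed by `X`. -/
theorem card_touched_not_crossed_le (hX : ((windmillGraph p q).induce X).Connected) (hz : z ∉ X) :
    (Finset.univ.filter fun k : Fin p =>
      (u k ∈ X ∨ u (finRotate p k) ∈ X) ∧ ¬ Crosses X k).card ≤ 2 := by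
  have h := card_u_le_card_crosses_add_one hX hz
  set U := Finset.univ.filter fun k : Fin p => u k ∈ X with hU
  set U' := Finset.univ.filter fun k : Fin p => u (finRotate p k) ∈ X with hU'
  set T := Finset.univ.filter fun k : Fin p => Crosses X k with hT
  have hUU' : U'.card = U.card := by
    refine Finset.card_bij (fun k _ => finRotate p k) ?_ ?_ ?_
    · simp [hU, hU', -finRotate_apply]
    · intro a _ b _ hab; exact (finRotate p).injective hab
    · intro b hb
      refine ⟨(finRotate p).symm b, ?_, by simp [-finRotate_apply, -finRotate_symm_apply]⟩
      simpa [hU, hU', -finRotate_apply, -finRotate_symm_apply] using hb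
  have hTU : T ⊆ U := fun k hk => by simp [hU, hT] at hk ⊢; exact hk.1
  have hTU' : T ⊆ U' := fun k hk => by
    simp [hU', hT, -finRotate_apply] at hk ⊢; exact hk.2.1
  have h1 := Finset.card_sdiff_add_card_eq_card hTU
  have h2 := Finset.card_sdiff_add_card_eq_card hTU'
  -- U and U' are the vanes whose first, respectively second, end is in X. They have the same size,
  -- and each exceeds T by at most one.
  have h3 : (Finset.univ.filter fun k : Fin p =>
      (u k ∈ X ∨ u (finRotate p k) ∈ X) ∧ ¬ Crosses X k) ⊆ (U \ T) ∪ (U' \ T) := fun k hk => by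
    simp [hU, hU', hT, -finRotate_apply] at hk ⊢
    tauto
  have h4 := (Finset.card_le_card h3).trans (Finset.card_union_le _ _)
  omega

end WindmillVertex

/-! ### Counting the branch sets of a rooted model -/

namespace WindmillVertex

variable {p q : ℕ} {ι : Type*} {X X' : Set (WindmillVertex p q)}
  {Y : ι → Set (WindmillVertex p q)} {s : ι → Fin p} {r : ι → ℕ}

/-- The sets `X`, `X'` and `Y j` are the branch sets of a rooted `K_{2,ι}`-model, and the set `Y j`
contains the root in row `r j` of the vane `s j`. -/
structure IsRootedModel (X X' : Set (WindmillVertex p q)) (Y : ι → Set (WindmillVertex p q))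
    (s : ι → Fin p) (r : ι → ℕ) : Prop where
  connX : ((windmillGraph p q).induce X).Connected
  connX' : ((windmillGraph p q).induce X').Connected
  connY : ∀ j, ((windmillGraph p q).induce (Y j)).Connected
  disjXX' : Disjoint X X'
  disjX : ∀ j, Disjoint X (Y j)
  disjX' : ∀ j, Disjoint X' (Y j)
  disjY : ∀ j k, j ≠ k → Disjoint (Y j) (Y k)
  adjX : ∀ j, ∃ x ∈ X, ∃ y ∈ Y j, (windmillGraph p q).Adj x y
  adjX' : ∀ j, ∃ x ∈ X', ∃ y ∈ Y j, (windmillGraph p q).Adj x y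
  root_mem : ∀ j, colB (s j) (r j) ∈ Y j
  root_odd : ∀ j, Odd (r j)
  root_le : ∀ j, r j ≤ 2 * q

namespace IsRootedModel

theorem symm (h : IsRootedModel X X' Y s r) : IsRootedModel X' X Y s r :=
  ⟨h.connX', h.connX, h.connY, h.disjXX'.symm, h.disjX', h.disjX, h.disjY, h.adjX', h.adjX,
    h.root_mem, h.root_odd, h.root_le⟩

theorem eq_of_mem (h : IsRootedModel X X' Y s r) {j k : ι} {x : WindmillVertex p q} (hj : x ∈ Y j)
    (hk : x ∈ Y k) : j = k := by
  by_contra hjk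
  exact Set.disjoint_left.1 (h.disjY j k hjk) hj hk

open Classical in
theorem card_filter_mem_le_one [Fintype ι] (h : IsRootedModel X X' Y s r)
    (x : WindmillVertex p q) : (Finset.univ.filter fun j => x ∈ Y j).card ≤ 1 := by
  refine Finset.card_le_one.2 fun j hj k hk => ?_
  simp at hj hk
  exact h.eq_of_mem hj hk

-- A vane has q roots, in the odd rows 1, 3, ..., 2q - 1, and disjoint branch sets contain different
-- ones.
open Classical in
theorem card_filter_vane_le [Fintype ι] (h : IsRootedModel X X' Y s r) (i : Fin p) :
    (Finset.univ.filter fun j => s j = i).card ≤ q := by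
  have := Finset.card_le_card_of_injOn (s := Finset.univ.filter fun j => s j = i)
    (t := Finset.range q) (fun j => r j / 2) (fun j _ => ?_) (fun j hj k hk hjk => ?_)
  · simpa using this
  · have h1 := h.root_odd j
    have h2 := h.root_le j
    rw [Nat.odd_iff] at h1
    simp; omega
  · have h1 := h.root_odd j
    have h2 := h.root_odd k
    simp only [Finset.coe_filter, Finset.mem_univ, true_and, Set.mem_ofPred_eq] at hj hk hjk
    rw [Nat.odd_iff] at h1 h2
    have h3 : r j = r k := by omega
    refine h.eq_of_mem (h.root_mem j) ?_
    rw [hj, ← hk, h3]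
    exact h.root_mem k

/-- A branch set with a root in the `i`-th vane that contains neither an end of this vane nor the
centre lies inside the vane. -/
theorem subset_vane (h : IsRootedModel X X' Y s r) {j : ι} (h1 : u (s j) ∉ Y j)
    (h2 : u (finRotate p (s j)) ∉ Y j) (hz : z ∉ Y j) : Y j ⊆ vane (s j) := by
  by_contra hsub
  rcases exists_attachment (h.connY j) (h.root_mem j) (colB_mem_vane _ _) hsub with h' | h' | h'
  exacts [h1 h', h2 h', hz h']

-- A branch set adjacent to X either has its root in the vane or contains one of the three
-- attachments u_i, u_{i+1}, z.
open Classical in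
theorem card_le_of_subset_vane [Fintype ι] (h : IsRootedModel X X' Y s r) {i : Fin p}
    (hX : X ⊆ vane i) : Fintype.card ι ≤ q + 3 := by
  have key : ∀ j, s j = i ∨ u i ∈ Y j ∨ u (finRotate p i) ∈ Y j ∨ z ∈ Y j := fun j => by
    by_contra! hj
    obtain ⟨hs, h1, h2, h3⟩ := hj
    obtain ⟨x, hx, y, hy, hxy⟩ := h.adjX j
    have hyi : y ∈ vane i := by
      by_contra hyi
      rcases eq_of_adj_of_mem_vane hxy (hX hx) hyi with rfl | rfl | ⟨rfl, -⟩
      exacts [h1 hy, h2 hy, h3 hy]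
    have hsub : ¬ Y j ⊆ vane i := fun hsub =>
      hs (eq_of_mem_vane (colB_mem_vane _ _) (hsub (h.root_mem j)))
    rcases exists_attachment (h.connY j) hy hyi hsub with h' | h' | h'
    exacts [h1 h', h2 h', h3 h']
  have hsub : (Finset.univ : Finset ι) ⊆ (Finset.univ.filter fun j => s j = i) ∪
      ((Finset.univ.filter fun j => u i ∈ Y j) ∪
      ((Finset.univ.filter fun j => u (finRotate p i) ∈ Y j) ∪
      (Finset.univ.filter fun j => z ∈ Y j))) := fun j _ => by
    simpa [-finRotate_apply] using key j
  have h0 := Finset.card_le_card hsub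
  have h1 := h.card_filter_vane_le i
  have h2 := h.card_filter_mem_le_one (u i)
  have h3 := h.card_filter_mem_le_one (u (finRotate p i))
  have h4 := h.card_filter_mem_le_one z
  have h5 := Finset.card_union_le (Finset.univ.filter fun j => s j = i)
    ((Finset.univ.filter fun j => u i ∈ Y j) ∪
      ((Finset.univ.filter fun j => u (finRotate p i) ∈ Y j) ∪
      (Finset.univ.filter fun j => z ∈ Y j)))
  have h6 := Finset.card_union_le (Finset.univ.filter fun j => u i ∈ Y j)
      ((Finset.univ.filter fun j => u (finRotate p i) ∈ Y j) ∪
      (Finset.univ.filter fun j => z ∈ Y j))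
  have h7 := Finset.card_union_le (Finset.univ.filter fun j => u (finRotate p i) ∈ Y j)
      (Finset.univ.filter fun j => z ∈ Y j)
  rw [Finset.card_univ] at h0
  omega

theorem exists_u_mem (hX : ((windmillGraph p q).induce X).Connected) (hz : z ∉ X)
    (hv : ∀ i, ¬ X ⊆ vane i) : ∃ k, u k ∈ X := by
  obtain ⟨x, hx⟩ := (SimpleGraph.induce_connected_iff.1 hX).1
  rcases cases_vane x with rfl | ⟨k, rfl⟩ | ⟨i, hi⟩
  · exact (hz hx).elim
  · exact ⟨k, hx⟩
  · rcases exists_attachment hX hx hi (hv i) with h | h | h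
    exacts [⟨_, h⟩, ⟨_, h⟩, (hz h).elim]

/-- A branch set with a root in a vane that `X'` does not touch contains an end of this vane. -/
theorem exists_end_mem (h : IsRootedModel X X' Y s r) (hz : z ∉ X') (hv : ∀ i, ¬ X' ⊆ vane i)
    {j : ι} (hzj : z ∉ Y j) (h1 : u (s j) ∉ X') (h2 : u (finRotate p (s j)) ∉ X') :
    ∃ k, u k ∉ X' ∧ u k ∈ Y j := by
  by_contra! hno
  have hY := h.subset_vane (fun h' => hno _ h1 h') (fun h' => hno _ h2 h') hzj
  obtain ⟨x, hx, y, hy, hxy⟩ := h.adjX' j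
  by_cases hxi : x ∈ vane (s j)
  · rcases exists_attachment h.connX' hx hxi (hv _) with h' | h' | h'
    exacts [h1 h', h2 h', hz h']
  · rcases eq_of_adj_of_mem_vane hxy.symm (hY hy) hxi with rfl | rfl | ⟨rfl, -⟩
    exacts [h1 hx, h2 hx, hz hx]

/-- A branch set with a root in a vane crossed by `X'` lies inside this vane. -/
theorem subset_vane_of_crosses (h : IsRootedModel X X' Y s r) {j : ι} (hzj : z ∉ Y j)
    (hc : Crosses X' (s j)) : Y j ⊆ vane (s j) :=
  h.subset_vane (fun h' => Set.disjoint_left.1 (h.disjX' j) hc.1 h')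
    (fun h' => Set.disjoint_left.1 (h.disjX' j) hc.2.1 h') hzj

/-- Both ends of the vane belong to X', so the centre is the only attachment through which X can
touch a branch set inside the vane. -/
theorem z_mem_of_crosses (h : IsRootedModel X X' Y s r) (hv : ∀ i, ¬ X ⊆ vane i)
    {j : ι} (hzj : z ∉ Y j) (hc : Crosses X' (s j)) : z ∈ X := by
  have hu : ∀ {k}, u k ∈ X' → u k ∉ X := fun h' h'' => Set.disjoint_left.1 h.disjXX' h'' h'
  obtain ⟨x, hx, y, hy, hxy⟩ := h.adjX j
  by_cases hxi : x ∈ vane (s j)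
  · rcases exists_attachment h.connX hx hxi (hv _) with h' | h' | h'
    exacts [(hu hc.1 h').elim, (hu hc.2.1 h').elim, h']
  · rcases eq_of_adj_of_mem_vane hxy.symm (h.subset_vane_of_crosses hzj hc hy) hxi with
      rfl | rfl | ⟨rfl, -⟩
    exacts [(hu hc.1 hx).elim, (hu hc.2.1 hx).elim, hx]

/-- If `X'` encloses a part of the vane, then every branch set inside the vane contains a vertex of
the second path that lies below the enclosing row and has a neighbour in `X`. -/
theorem exists_colB_mem (h : IsRootedModel X X' Y s r) {i : Fin p} {k : ℕ}
    (hX' : Encloses X' i k) (hz : z ∈ X) {j : ι} (hY : Y j ⊆ vane i) :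
    ∃ m, 1 ≤ m ∧ m < k ∧ colB i m ∈ Y j ∧ (∀ m' < m, (colB i m : WindmillVertex p q) ∈ middle i m' k) ∧
      ∃ x ∈ X, (windmillGraph p q).Adj x (colB i m) := by
  have hXX' : ∀ {x}, x ∈ X → x ∉ X' := fun h1 h2 => Set.disjoint_left.1 h.disjXX' h1 h2
  have hYX' : ∀ {x}, x ∈ Y j → x ∉ X' := fun h1 h2 => Set.disjoint_left.1 (h.disjX' j) h2 h1
  have hX : ∀ x ∈ X, ¬ (x ∈ vane i ∧ x ∉ middle i 0 k) := fun x hx hxi => by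
    obtain ⟨a, ha, hai, b, hb, hbi, hab⟩ := SimpleGraph.exists_adj_of_connected h.connX hx
      (T := {x | x ∈ vane i ∧ x ∉ middle i 0 k}) hxi (fun hsub => z_notMem_vane (hsub hz).1)
    exact hbi (hX'.mem_of_adj hab hai.1 hai.2 (hXX' ha) (hXX' hb))
  obtain ⟨x, hx, y, hy, hxy⟩ := h.adjX j
  have hym : y ∈ middle i 0 k := by
    by_contra hym
    exact hX x hx (hX'.mem_of_adj hxy.symm (hY hy) hym (hYX' hy) (hXX' hx))
  obtain ⟨m, hm0, hmk, rfl, hmm⟩ := exists_eq_colB_of_mem_middle hym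
  exact ⟨m, hm0, hmk, hy, hmm, x, hx, hxy⟩

/-- X reaches the enclosed segment of the second path only from z, starting at v_i. The first branch
set with a vertex on the segment next to X blocks the segment, so X cannot reach a second one. -/
theorem eq_of_crosses (h : IsRootedModel X X' Y s r) (hp : 2 ≤ p) (hq : 1 ≤ q)
    (hv : ∀ i, ¬ X ⊆ vane i) {j j' : ι} (hzj : z ∉ Y j) (hzj' : z ∉ Y j')
    (hc : Crosses X' (s j)) (hjj' : s j' = s j) : j = j' := by
  have hz := h.z_mem_of_crosses hv hzj hc
  obtain ⟨k, hk⟩ := exists_encloses hp hq hc.1 hc.2.1 hc.2.2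
  have hY := h.subset_vane_of_crosses hzj hc
  have hY' := h.subset_vane_of_crosses hzj' (hjj' ▸ hc)
  rw [hjj'] at hY'
  have hXX' : ∀ {x}, x ∈ X → x ∉ X' := fun h1 h2 => Set.disjoint_left.1 h.disjXX' h1 h2
  -- If b_m belongs to a branch set, a neighbour of b_{m'} in X would have to lie beyond b_m and be
  -- joined to z within X through b_m.
  have key : ∀ j' m m', m < m' → 1 ≤ m → colB (s j) m ∈ Y j' →
      (colB (s j) m' : WindmillVertex p q) ∈ middle (s j) m k →
      (∃ x ∈ X, (windmillGraph p q).Adj x (colB (s j) m')) → False := by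
    rintro j' m m' hmm' hm hmY hm'k ⟨x, hx, hadj⟩
    have hmX : colB (s j) m ∉ X := fun h' => Set.disjoint_left.1 (h.disjX j') h' hmY
    by_cases hxm : x ∈ middle (s j) m k
    · obtain ⟨a, ha, hai, b, hb, hbi, hab⟩ := SimpleGraph.exists_adj_of_connected h.connX hx hxm
        (fun hsub => z_notMem_vane (middle_subset_vane (hsub hz)))
      rcases hk.eq_of_adj hab hai hbi (hXX' hb) with ⟨rfl, -⟩ | ⟨-, rfl⟩
      · omega
      · exact hmX hb
    · rcases hk.eq_of_adj hadj.symm hm'k hxm (hXX' hx) with ⟨rfl, -⟩ | ⟨-, rfl⟩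
      · omega
      · exact hmX hx
  obtain ⟨m, hm1, hmk, hmY, hmm, hmx⟩ := h.exists_colB_mem hk hz hY
  obtain ⟨m', hm1', hmk', hmY', hmm', hmx'⟩ := h.exists_colB_mem hk hz hY'
  rcases lt_trichotomy m m' with hlt | rfl | hlt
  · exact (key j m m' hlt hm1 hmY (hmm' m hlt) hmx').elim
  · exact h.eq_of_mem hmY hmY'
  · exact (key j' m' m hlt hm1' hmY' (hmm m' hlt) hmx).elim

-- The branch sets split into those containing z (J₀), and those rooted in crossed (J₁), touched but
-- uncrossed (J₂) or untouched (J₃) vanes. The bounds |U| for J₀ ∪ J₁, 2q for J₂ and p - |U| for J₃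
-- add up to p + 2q.
open Classical in
theorem card_le_of_z_notMem [Fintype ι] (h : IsRootedModel X X' Y s r) (hp : 2 ≤ p) (hq : 1 ≤ q)
    (hz : z ∉ X') (hv : ∀ i, ¬ X ⊆ vane i) (hv' : ∀ i, ¬ X' ⊆ vane i) :
    Fintype.card ι ≤ p + 2 * q := by
  set U := Finset.univ.filter fun k : Fin p => u k ∈ X' with hU
  set N := Finset.univ.filter fun k : Fin p => u k ∉ X' with hN
  set T := Finset.univ.filter fun k : Fin p => Crosses X' k with hT
  set D := Finset.univ.filter fun k : Fin p =>
      (u k ∈ X' ∨ u (finRotate p k) ∈ X') ∧ ¬ Crosses X' k with hD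
  set J₀ := Finset.univ.filter fun j => z ∈ Y j with hJ₀
  set J₁ := Finset.univ.filter fun j => z ∉ Y j ∧ Crosses X' (s j) with hJ₁
  set J₂ := Finset.univ.filter fun j => s j ∈ D with hJ₂
  set J₃ := Finset.univ.filter fun j =>
    z ∉ Y j ∧ u (s j) ∉ X' ∧ u (finRotate p (s j)) ∉ X' with hJ₃
  have hcover : (Finset.univ : Finset ι) ⊆ (J₀ ∪ J₁) ∪ (J₂ ∪ J₃) := fun j _ => by
    simp [hJ₀, hJ₁, hJ₂, hJ₃, hD, -finRotate_apply]
    tauto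
  have hUN : U.card + N.card = p := by
    simpa using Finset.card_filter_add_card_filter_not (s := (Finset.univ : Finset (Fin p)))
      (fun k => u k ∈ X')
  have hU1 : 1 ≤ U.card := by
    obtain ⟨k, hk⟩ := exists_u_mem h.connX' hz hv'
    exact Finset.card_pos.2 ⟨k, by simpa [hU] using hk⟩
  have hTU : T.card ≤ U.card := Finset.card_le_card fun k hk => by
    simp [hU, hT] at hk ⊢; exact hk.1
  have h₀ : J₀.card ≤ 1 := h.card_filter_mem_le_one z
  have h₁ : J₁.card ≤ T.card := by
    refine Finset.card_le_card_of_injOn s (fun j hj => ?_) (fun j hj j' hj' hjj' => ?_)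
    · simp [hJ₁, hT] at hj ⊢; exact hj.2
    · simp [hJ₁] at hj hj'
      exact h.eq_of_crosses hp hq hv hj.1 hj'.1 hj.2 hjj'.symm
  -- If J₁ is nonempty, then z lies in X and J₀ is empty. The unit saved here is needed: for t = 6
  -- there is p + 2q + 1 = t.
  have h₀₁ : (J₀ ∪ J₁).card ≤ U.card := by
    rcases J₁.eq_empty_or_nonempty with h' | ⟨j, hj⟩
    · rw [h', Finset.union_empty]; omega
    · have hj' : z ∉ Y j ∧ Crosses X' (s j) := by simpa [hJ₁] using hj
      have hzX := h.z_mem_of_crosses hv hj'.1 hj'.2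
      have : J₀ = ∅ := by
        ext k; simpa [hJ₀] using fun hk => Set.disjoint_left.1 (h.disjX k) hzX hk
      rw [this, Finset.empty_union]; omega
  have h₂ : J₂.card ≤ D.card * q := by
    rw [mul_comm]
    refine Finset.card_le_mul_card_image_of_maps_to (f := s) (fun j hj => ?_) q (fun i _ => ?_)
    · simpa [hJ₂] using hj
    · exact (Finset.card_le_card fun j hj => by simp at hj ⊢; exact hj.2).trans
        (h.card_filter_vane_le i)
  have hD2 : D.card ≤ 2 := card_touched_not_crossed_le h.connX' hz
  have h₂' : J₂.card ≤ 2 * q := h₂.trans (Nat.mul_le_mul_right q hD2)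
  have h₃ : J₃.card ≤ N.card := by
    have hex : ∀ j, ∃ k, j ∈ J₃ → u k ∉ X' ∧ u k ∈ Y j := fun j => by
      by_cases hj : j ∈ J₃
      · have hj' := hj
        simp only [hJ₃, Finset.mem_filter, Finset.mem_univ, true_and] at hj'
        obtain ⟨k, hk⟩ := h.exists_end_mem hz hv' hj'.1 hj'.2.1 hj'.2.2
        exact ⟨k, fun _ => hk⟩
      · exact ⟨s j, fun h => (hj h).elim⟩
    choose f hf using hex
    refine Finset.card_le_card_of_injOn f (fun j hj => ?_) (fun j hj j' hj' hjj' => ?_)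
    · simpa [hN] using (hf j hj).1
    · exact h.eq_of_mem (hf j hj).2 (hjj' ▸ (hf j' hj').2)
  have hc := Finset.card_le_card hcover
  have hc1 := Finset.card_union_le (J₀ ∪ J₁) (J₂ ∪ J₃)
  have hc2 := Finset.card_union_le J₂ J₃
  rw [Finset.card_univ] at hc
  omega

/-- The hubs are disjoint, so one of them misses z and the roles can be exchanged. From 5q ≤ 2p and
p ≥ 3 both q + 3 and p + 2q are less than 2p. -/
theorem card_lt [Fintype ι] (h : IsRootedModel X X' Y s r) (hp : 3 ≤ p) (hq : 1 ≤ q)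
    (hpq : 5 * q ≤ 2 * p) : Fintype.card ι < 2 * p := by
  by_cases hv : ∃ i, X ⊆ vane i
  · obtain ⟨i, hi⟩ := hv
    have := h.card_le_of_subset_vane hi
    omega
  by_cases hv' : ∃ i, X' ⊆ vane i
  · obtain ⟨i, hi⟩ := hv'
    have := h.symm.card_le_of_subset_vane hi
    omega
  push Not at hv hv'
  by_cases hz : z ∈ X'
  · have := h.symm.card_le_of_z_notMem (by omega) hq
      (fun hz' => Set.disjoint_left.1 h.disjXX' hz' hz) hv' hv
    omega
  · have := h.card_le_of_z_notMem (by omega) hq hz hv hv'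
    omega

end IsRootedModel

end WindmillVertex

theorem windmill_not_hasRootedK2Minor {t : ℕ} (ht : 6 ≤ t) (hev : Even t) :
    ¬ HasRootedK2Minor (windmill t) (windmillRoots t) t := by
  rintro ⟨M, hM, hroot⟩
  choose x hx hxM using hroot
  choose s r hr hxr using hx
  have hm : WindmillVertex.IsRootedModel (M (Sum.inl 0)) (M (Sum.inl 1)) (fun j => M (Sum.inr j))
      s (fun j => r j) :=
    { connX := hM.connected _
      connX' := hM.connected _
      connY := fun j => hM.connected _
      disjXX' := hM.disjoint _ _ (by simp)
      disjX := fun j => hM.disjoint _ _ (by simp)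
      disjX' := fun j => hM.disjoint _ _ (by simp)
      disjY := fun j k hjk => hM.disjoint _ _ (by simpa using hjk)
      adjX := fun j => hM.edge _ _ (by simp)
      adjX' := fun j => hM.edge _ _ (by simp)
      root_mem := fun j => by
        rw [← WindmillVertex.pathB_eq, ← hxr j]
        exact hxM j
      root_odd := hr
      root_le := fun j => (r j).2.2 }
  obtain ⟨k, hk⟩ := hev
  have := hm.card_lt (by omega) (by omega) (by omega)
  rw [Fintype.card_fin] at this
  omega

/-! ### The windmill is 3-connected -/

/-- Three pairwise disjoint sets cannot all be hit by a set of at most two elements. -/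
theorem exists_disjoint_of_card_lt_three {V : Type*} {X : Finset V} (hX : X.card < 3)
    {P : Fin 3 → Set V} (hP : ∀ i j, i ≠ j → Disjoint (P i) (P j)) :
    ∃ i, P i ⊆ (X : Set V)ᶜ := by
  classical
  by_contra! h
  have h' : ∀ i, ∃ x ∈ X, x ∈ P i := fun i => by
    obtain ⟨x, hx, hxX⟩ := Set.not_subset.1 (h i)
    exact ⟨x, by simpa using hxX, hx⟩
  choose f hf hfP using h'
  have hinj : Function.Injective f := fun i j hij => by
    by_contra hne
    exact Set.disjoint_left.1 (hP i j hne) (hfP i) (hij ▸ hfP j)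
  have := Finset.card_le_card_of_injOn (s := Finset.univ) f (fun i _ => hf i) hinj.injOn
  simp at this
  omega

namespace WindmillVertex

variable {p q : ℕ}

/-- The cycle `u 1, v 1, u 2, v 2, …`. -/
def rim : Set (WindmillVertex p q) :=
  {x | match x with
    | u _ | v _ => True
    | _ => False}

/-- The first `k` vertices of the first path of the `i`-th vane. -/
def legA (i : Fin p) (k : ℕ) : Set (WindmillVertex p q) :=
  {x | match x with
    | u i' => i' = i
    | a i' j => i' = i ∧ (j : ℕ) ≤ k
    | _ => False}

/-- The first `k` vertices of the second path of the `i`-th vane. -/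
def legB (i : Fin p) (k : ℕ) : Set (WindmillVertex p q) :=
  {x | match x with
    | v i' => i' = i
    | b i' j => i' = i ∧ (j : ℕ) ≤ k
    | _ => False}

/-- The first `k` vertices of the third path of the `i`-th vane. -/
def legC (i : Fin p) (k : ℕ) : Set (WindmillVertex p q) :=
  {x | match x with
    | u i' => i' = finRotate p i
    | c i' j => i' = i ∧ (j : ℕ) ≤ k
    | _ => False}

/-- The vertices of the first path of the `i`-th vane beyond row `k`. -/
def tipA (i : Fin p) (k : ℕ) : Set (WindmillVertex p q) :=
  {x | match x with
    | a i' j => i' = i ∧ k < (j : ℕ)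
    | _ => False}

/-- The vertices of the third path of the `i`-th vane beyond row `k`. -/
def tipC (i : Fin p) (k : ℕ) : Set (WindmillVertex p q) :=
  {x | match x with
    | c i' j => i' = i ∧ k < (j : ℕ)
    | _ => False}

theorem colA_mem_legA {i : Fin p} {j k : ℕ} (h : j ≤ k) :
    (colA i j : WindmillVertex p q) ∈ legA i k := by
  unfold colA; split_ifs <;> simp [legA, h]

theorem colB_mem_legB {i : Fin p} {j k : ℕ} (h : j ≤ k) :
    (colB i j : WindmillVertex p q) ∈ legB i k := by
  unfold colB; split_ifs <;> simp [legB, h]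

theorem colC_mem_legC {i : Fin p} {j k : ℕ} (h : j ≤ k) :
    (colC i j : WindmillVertex p q) ∈ legC i k := by
  unfold colC; split_ifs <;> simp [legC, h]

theorem reachableIn_legA (i : Fin p) {k : ℕ} (h1 : 1 ≤ k) (hk : k ≤ 2 * q) :
    (windmillGraph p q).ReachableIn (legA i k) (colA i k) (u i) := by
  have := SimpleGraph.reachableIn_chain (G := windmillGraph p q) (S := legA i k) (f := colA i) h1
    (fun j h2 h3 => adj_colA i h2 (by omega)) (fun j _ h => colA_mem_legA h)
  rw [colA_one] at this
  exact this.symm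

theorem reachableIn_legB (i : Fin p) {k : ℕ} (h1 : 1 ≤ k) (hk : k ≤ 2 * q) :
    (windmillGraph p q).ReachableIn (legB i k) (colB i k) (v i) := by
  have := SimpleGraph.reachableIn_chain (G := windmillGraph p q) (S := legB i k) (f := colB i) h1
    (fun j h2 h3 => adj_colB i h2 (by omega)) (fun j _ h => colB_mem_legB h)
  rw [colB_one] at this
  exact this.symm

theorem reachableIn_legC (i : Fin p) {k : ℕ} (h1 : 1 ≤ k) (hk : k ≤ 2 * q) :
    (windmillGraph p q).ReachableIn (legC i k) (colC i k) (u (finRotate p i)) := by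
  have := SimpleGraph.reachableIn_chain (G := windmillGraph p q) (S := legC i k) (f := colC i) h1
    (fun j h2 h3 => adj_colC i h2 (by omega)) (fun j _ h => colC_mem_legC h)
  rw [colC_one] at this
  exact this.symm

theorem reachableIn_tipA (i : Fin p) {k : ℕ} (h1 : 2 ≤ k) (hk : k ≤ 2 * q) :
    (windmillGraph p q).ReachableIn (insert (colA i k) (tipA i k)) (colA i k)
      (colA i (2 * q)) := by
  refine SimpleGraph.reachableIn_chain (f := colA i) hk
    (fun j h2 h3 => adj_colA i (by omega) (by omega)) (fun j h2 h3 => ?_)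
  rcases h2.eq_or_lt with rfl | h2
  · exact .inl rfl
  · right; rw [colA_of_mem ⟨by omega, h3⟩]; simp [tipA, h2]

theorem reachableIn_tipC (i : Fin p) {k : ℕ} (h1 : 2 ≤ k) (hk : k ≤ 2 * q) :
    (windmillGraph p q).ReachableIn (insert (colC i k) (tipC i k)) (colC i k)
      (colC i (2 * q)) := by
  refine SimpleGraph.reachableIn_chain (f := colC i) hk
    (fun j h2 h3 => adj_colC i (by omega) (by omega)) (fun j h2 h3 => ?_)
  rcases h2.eq_or_lt with rfl | h2
  · exact .inl rfl
  · right; rw [colC_of_mem ⟨by omega, h3⟩]; simp [tipC, h2]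

/-- At most two deleted vertices cannot hit all three paths of a fan from x. -/
theorem exists_rim_of_fan {X : Finset (WindmillVertex p q)} (hX : X.card < 3)
    {x : WindmillVertex p q} (hx : x ∉ X) (P : Fin 3 → Set (WindmillVertex p q))
    (hP : ∀ i j, i < j → Disjoint (P i) (P j))
    (hreach : ∀ i, ∃ w ∈ rim, w ∈ P i ∧ (windmillGraph p q).ReachableIn (insert x (P i)) x w) :
    ∃ w ∈ rim, w ∉ X ∧ (windmillGraph p q).ReachableIn (X : Set (WindmillVertex p q))ᶜ x w := by
  obtain ⟨n, hn⟩ := exists_disjoint_of_card_lt_three hX (P := P) (fun i j hij => by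
    rcases lt_or_gt_of_ne hij with h | h
    exacts [hP i j h, (hP j i h).symm])
  obtain ⟨w, hw, hwP, hr⟩ := hreach n
  exact ⟨w, hw, by simpa using hn hwP, hr.mono (Set.insert_subset (by simpa using hx) hn)⟩

theorem u_mem_rim {k : Fin p} : (u k : WindmillVertex p q) ∈ rim := trivial

theorem v_mem_rim {k : Fin p} : (v k : WindmillVertex p q) ∈ rim := trivial

/-- After deleting at most two vertices, every vertex still reaches the rim. -/
theorem exists_reachable_rim (hp : 3 ≤ p) {X : Finset (WindmillVertex p q)} (hX : X.card < 3)
    {x : WindmillVertex p q} (hx : x ∉ X) :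
    ∃ w ∈ rim, w ∉ X ∧ (windmillGraph p q).ReachableIn (X : Set (WindmillVertex p q))ᶜ x w := by
  have hrot := finRotate_ne_self (show 2 ≤ p by omega)
  cases x with
  | u i => exact ⟨u i, trivial, hx, .refl _⟩
  | v i => exact ⟨v i, trivial, hx, .refl _⟩
  | z =>
    refine exists_rim_of_fan hX hx (fun n => {u ⟨n, by omega⟩}) (fun i j hij => ?_) (fun i => ?_)
    · simpa [Fin.ext_iff] using hij.ne
    · exact ⟨_, u_mem_rim, rfl, (Step.zu _).adj.reachableIn (by simp) (by simp)⟩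
  | a i j =>
    obtain ⟨j, hj⟩ := j
    have h2 := hj.1
    have h3 := hj.2
    -- The three routes from a_{i,j}: down the first path, across the rung and down the second path,
    -- or up to the end edge and down the third path.
    refine exists_rim_of_fan hX hx ![legA i (j - 1), legB i j, tipA i j ∪ legC i (2 * q)] ?_ ?_
    · intro m n hmn
      fin_cases m <;> fin_cases n <;> simp [-Set.disjoint_union_right] at hmn ⊢ <;>
        rw [Set.disjoint_left] <;>
        intro x h1 h2 <;> cases x <;> simp [legA, legB, legC, tipA, -finRotate_apply] at h1 h2 <;>
        grind
    · intro n
      rw [← colA_of_mem hj]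
      fin_cases n
      · refine ⟨u i, u_mem_rim, rfl, .trans (SimpleGraph.Adj.reachableIn ?_ (.inl rfl) ?_)
          ((reachableIn_legA i (k := j - 1) (by omega) (by omega)).mono (Set.subset_insert _ _))⟩
        · have := adj_colA (q := q) i (j := j - 1) (by omega) (by omega)
          rw [Nat.sub_add_cancel (by omega)] at this
          exact this.symm
        · exact .inr (colA_mem_legA le_rfl)
      · exact ⟨v i, v_mem_rim, rfl, .trans ((adj_colA_colB i hj).reachableIn (.inl rfl)
          (.inr (colB_mem_legB le_rfl)))
          ((reachableIn_legB i (by omega) h3).mono (Set.subset_insert _ _))⟩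
      · refine ⟨u (finRotate p i), u_mem_rim, .inr rfl, .trans (.trans
          ((reachableIn_tipA i h2 h3).mono (Set.insert_subset_insert Set.subset_union_left))
          ((adj_colA_colC i (by omega)).reachableIn ?_ ?_))
          ((reachableIn_legC i (by omega) le_rfl).mono
            (Set.subset_union_right.trans (Set.subset_insert _ _)))⟩
        · rcases h3.eq_or_lt with rfl | h3
          · exact .inl rfl
          · refine .inr (.inl ?_)
            rw [colA_of_mem ⟨by omega, le_rfl⟩]; simp [tipA, h3]
        · exact .inr (.inr (colC_mem_legC le_rfl))
  | b i j =>
    obtain ⟨j, hj⟩ := j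
    have h2 := hj.1
    have h3 := hj.2
    refine exists_rim_of_fan hX hx ![legA i j, legB i (j - 1), legC i j] ?_ ?_
    · intro m n hmn
      fin_cases m <;> fin_cases n <;> simp [-Set.disjoint_union_right] at hmn ⊢ <;>
        rw [Set.disjoint_left] <;>
        intro x h1 h2 <;> cases x <;> simp [legA, legB, legC, -finRotate_apply] at h1 h2 <;>
        grind
    · intro n
      rw [← colB_of_mem hj]
      fin_cases n
      · exact ⟨u i, u_mem_rim, rfl, .trans ((adj_colA_colB i hj).symm.reachableIn (.inl rfl)
          (.inr (colA_mem_legA le_rfl)))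
          ((reachableIn_legA i (by omega) h3).mono (Set.subset_insert _ _))⟩
      · refine ⟨v i, v_mem_rim, rfl, .trans (SimpleGraph.Adj.reachableIn ?_ (.inl rfl) ?_)
          ((reachableIn_legB i (k := j - 1) (by omega) (by omega)).mono (Set.subset_insert _ _))⟩
        · have := adj_colB (q := q) i (j := j - 1) (by omega) (by omega)
          rw [Nat.sub_add_cancel (by omega)] at this
          exact this.symm
        · exact .inr (colB_mem_legB le_rfl)
      · exact ⟨u (finRotate p i), u_mem_rim, rfl, .trans ((adj_colB_colC i hj).reachableIn
          (.inl rfl) (.inr (colC_mem_legC le_rfl)))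
          ((reachableIn_legC i (by omega) h3).mono (Set.subset_insert _ _))⟩
  | c i j =>
    obtain ⟨j, hj⟩ := j
    have h2 := hj.1
    have h3 := hj.2
    refine exists_rim_of_fan hX hx ![legC i (j - 1), legB i j, tipC i j ∪ legA i (2 * q)] ?_ ?_
    · intro m n hmn
      fin_cases m <;> fin_cases n <;> simp [-Set.disjoint_union_right] at hmn ⊢ <;>
        rw [Set.disjoint_left] <;>
        intro x h1 h2 <;> cases x <;> simp [legA, legB, legC, tipC, -finRotate_apply] at h1 h2 <;>
        grind
    · intro n
      rw [← colC_of_mem hj]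
      fin_cases n
      · refine ⟨u (finRotate p i), u_mem_rim, rfl,
          .trans (SimpleGraph.Adj.reachableIn ?_ (.inl rfl) ?_)
          ((reachableIn_legC i (k := j - 1) (by omega) (by omega)).mono (Set.subset_insert _ _))⟩
        · have := adj_colC (q := q) i (j := j - 1) (by omega) (by omega)
          rw [Nat.sub_add_cancel (by omega)] at this
          exact this.symm
        · exact .inr (colC_mem_legC le_rfl)
      · exact ⟨v i, v_mem_rim, rfl, .trans ((adj_colB_colC i hj).symm.reachableIn (.inl rfl)
          (.inr (colB_mem_legB le_rfl)))
          ((reachableIn_legB i (by omega) h3).mono (Set.subset_insert _ _))⟩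
      · refine ⟨u i, u_mem_rim, .inr rfl, .trans (.trans
          ((reachableIn_tipC i h2 h3).mono (Set.insert_subset_insert Set.subset_union_left))
          ((adj_colA_colC i (by omega)).symm.reachableIn ?_ ?_))
          ((reachableIn_legA i (by omega) le_rfl).mono
            (Set.subset_union_right.trans (Set.subset_insert _ _)))⟩
        · rcases h3.eq_or_lt with rfl | h3
          · exact .inl rfl
          · refine .inr (.inl ?_)
            rw [colC_of_mem ⟨by omega, le_rfl⟩]; simp [tipC, h3]
        · exact .inr (.inr (colA_mem_legA le_rfl))

/-- The vertices of the rim in cyclic order. -/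
def rimVertex (hp : 0 < p) (n : ℕ) : WindmillVertex p q :=
  if n % 2 = 0 then u ⟨n / 2 % p, Nat.mod_lt _ hp⟩ else v ⟨n / 2 % p, Nat.mod_lt _ hp⟩

theorem rimVertex_mem_rim (hp : 0 < p) (n : ℕ) : (rimVertex hp n : WindmillVertex p q) ∈ rim := by
  unfold rimVertex; split_ifs <;> trivial

theorem finRotate_mk_mod (hp : 0 < p) (n : ℕ) :
    finRotate p ⟨n % p, Nat.mod_lt _ hp⟩ = ⟨(n + 1) % p, Nat.mod_lt _ hp⟩ := by
  obtain ⟨k, rfl⟩ : ∃ k, p = k + 1 := ⟨p - 1, by omega⟩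
  rw [finRotate_apply]
  ext
  simp [Fin.val_add]

theorem adj_rimVertex (hp : 0 < p) (n : ℕ) :
    (windmillGraph p q).Adj (rimVertex hp n) (rimVertex hp (n + 1)) := by
  rcases Nat.even_or_odd' n with ⟨k, rfl | rfl⟩
  · have h1 : 2 * k % 2 = 0 := by omega
    have h2 : ¬ (2 * k + 1) % 2 = 0 := by omega
    have h3 : (2 * k + 1) / 2 = 2 * k / 2 := by omega
    simp only [rimVertex, if_pos h1, if_neg h2, h3]
    exact (Step.uv _).adj
  · have h1 : (2 * k + 1 + 1) % 2 = 0 := by omega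
    have h2 : ¬ (2 * k + 1) % 2 = 0 := by omega
    have h3 : (2 * k + 1 + 1) / 2 = (2 * k + 1) / 2 + 1 := by omega
    simp only [rimVertex, if_pos h1, if_neg h2, h3]
    rw [← finRotate_mk_mod hp]
    exact (Step.vu _).adj

theorem exists_eq_rimVertex (hp : 0 < p) {x : WindmillVertex p q} (hx : x ∈ rim) :
    ∃ n < 2 * p, x = rimVertex hp n := by
  cases x with
  | u i =>
    refine ⟨2 * i, by omega, ?_⟩
    simp [rimVertex, Nat.mod_eq_of_lt i.2]
  | v i =>
    refine ⟨2 * i + 1, by omega, ?_⟩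
    have : (2 * (i : ℕ) + 1) / 2 = i := by omega
    simp [rimVertex, this, Nat.mod_eq_of_lt i.2]
  | _ => exact hx.elim

theorem rimVertex_add (hp : 0 < p) (n : ℕ) :
    (rimVertex hp (n + 2 * p) : WindmillVertex p q) = rimVertex hp n := by
  have h1 : (n + 2 * p) % 2 = n % 2 := by omega
  have h2 : (n + 2 * p) / 2 = n / 2 + p := by omega
  simp only [rimVertex, h1, h2, Nat.add_mod_right]

theorem rimVertex_ne (hp : 0 < p) {m n : ℕ} (hm : m < 2 * p) (h1 : m < n) (h2 : n < m + 2 * p) :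
    (rimVertex hp n : WindmillVertex p q) ≠ rimVertex hp m := by
  intro h
  have hmp : m / 2 % p = m / 2 := Nat.mod_eq_of_lt (by omega)
  have hnp : n / 2 % p = n / 2 ∨ p ≤ n / 2 ∧ n / 2 % p = n / 2 - p := by
    rcases lt_or_ge (n / 2) p with h' | h'
    · exact .inl (Nat.mod_eq_of_lt h')
    · refine .inr ⟨h', ?_⟩
      rw [Nat.mod_eq_sub_mod h', Nat.mod_eq_of_lt (by omega)]
  unfold rimVertex at h
  split_ifs at h <;> simp only [u.injEq, v.injEq, Fin.mk.injEq] at h <;>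
    rw [hmp] at h <;> rcases hnp with hnp | ⟨hnp', hnp⟩ <;> rw [hnp] at h <;> omega

/-- The rim minus a vertex is connected. -/
theorem reachableIn_rim_diff (hp : 0 < p) {r x y : WindmillVertex p q} (hx : x ∈ rim)
    (hy : y ∈ rim) (hxr : x ≠ r) (hyr : y ≠ r) :
    (windmillGraph p q).ReachableIn (rim \ {r}) x y := by
  by_cases hr : r ∈ rim
  · obtain ⟨m, hm, rfl⟩ := exists_eq_rimVertex hp hr
    have key : ∀ w ∈ rim, w ≠ rimVertex hp m → (windmillGraph p q).ReachableIn
        (rim \ {rimVertex hp m}) (rimVertex hp (m + 1)) w := fun w hw hwr => by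
      obtain ⟨n, hn1, hn2, rfl⟩ : ∃ n, m < n ∧ n < m + 2 * p ∧ w = rimVertex hp n := by
        obtain ⟨n, hn, rfl⟩ := exists_eq_rimVertex hp hw
        rcases lt_trichotomy m n with h | rfl | h
        · exact ⟨n, h, by omega, rfl⟩
        · exact (hwr rfl).elim
        · exact ⟨n + 2 * p, by omega, by omega, (rimVertex_add hp n).symm⟩
      exact SimpleGraph.reachableIn_chain (f := rimVertex hp) hn1 (fun k _ _ => adj_rimVertex hp k)
        (fun k h1 h2 => ⟨rimVertex_mem_rim hp k, rimVertex_ne hp hm h1 (by omega)⟩)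
    exact (key x hx hxr).symm.trans (key y hy hyr)
  · have key : ∀ w ∈ rim, (windmillGraph p q).ReachableIn (rim \ {r}) (rimVertex hp 0) w :=
      fun w hw => by
        obtain ⟨n, -, rfl⟩ := exists_eq_rimVertex hp hw
        refine SimpleGraph.reachableIn_chain (f := rimVertex hp) n.zero_le
          (fun k _ _ => adj_rimVertex hp k) (fun k _ _ => ⟨rimVertex_mem_rim hp k, ?_⟩)
        rintro rfl
        exact hr (rimVertex_mem_rim hp k)
    exact (key x hx).symm.trans (key y hy)

/-- If z survives, it joins all remaining rim vertices. If not, at most one further vertex is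
deleted, and a cycle minus a vertex is connected. -/
theorem reachableIn_compl_of_mem_rim (hp : 0 < p) {X : Finset (WindmillVertex p q)}
    (hX : X.card < 3) {x y : WindmillVertex p q} (hx : x ∈ rim) (hy : y ∈ rim) (hxX : x ∉ X)
    (hyX : y ∉ X) : (windmillGraph p q).ReachableIn (X : Set (WindmillVertex p q))ᶜ x y := by
  classical
  have hzw : ∀ w ∈ rim, (windmillGraph p q).Adj z w := fun w hw => by
    cases w with
    | u i => exact (Step.zu i).adj
    | v i => exact (Step.zv i).adj
    | _ => exact hw.elim
  by_cases hz : z ∈ X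
  · have hcard : (X.erase z).card ≤ 1 := by rw [Finset.card_erase_of_mem hz]; omega
    obtain ⟨r, hr⟩ : ∃ r, X.erase z ⊆ {r} := by
      rcases (X.erase z).eq_empty_or_nonempty with h | ⟨r, hr⟩
      · exact ⟨z, by simp [h]⟩
      · exact ⟨r, fun w hw => by
          simpa using Finset.card_le_one.1 hcard w hw r hr⟩
    by_cases hrX : r ∈ X
    · refine (reachableIn_rim_diff hp hx hy (fun h => hxX (h ▸ hrX))
        (fun h => hyX (h ▸ hrX))).mono fun w hw hwX => ?_
      have hwz : w ≠ z := by rintro rfl; exact hw.1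
      exact hw.2 (by simpa using hr (Finset.mem_erase.2 ⟨hwz, hwX⟩))
    -- Here only z is deleted; as z is not on the rim, removing it from the rim changes nothing.
    · have hzr : (z : WindmillVertex p q) ∉ rim := id
      refine (reachableIn_rim_diff hp hx hy (r := z) (fun h => hzr (h ▸ hx))
        (fun h => hzr (h ▸ hy))).mono fun w hw hwX => ?_
      have := hr (Finset.mem_erase.2 ⟨hw.2, hwX⟩)
      rw [Finset.mem_singleton] at this
      exact hrX (this ▸ hwX)
  · exact ((hzw x hx).symm.reachableIn (by simpa using hxX) (by simpa using hz)).trans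
      ((hzw y hy).reachableIn (by simpa using hz) (by simpa using hyX))

theorem windmillGraph_isVertexConnected (hp : 3 ≤ p) :
    (windmillGraph p q).IsVertexConnected 3 := by
  refine ⟨?_, fun X hX => SimpleGraph.induce_connected_iff.2 ⟨?_, fun x hx y hy => ?_⟩⟩
  · have := Nat.card_le_card_of_injective
      (fun x : Fin p ⊕ Fin p => (x.elim u v : WindmillVertex p q)) (by
        rintro (a | a) (b | b) <;> simp)
    simp at this
    omega
  · by_contra h
    rw [Set.not_nonempty_iff_eq_empty, Set.compl_empty_iff] at h
    have := Finset.card_le_card_of_injOn (s := (Finset.univ : Finset (Fin p))) (t := X)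
      (fun i => u i) (fun i _ => h.symm ▸ Set.mem_univ _) (fun i _ j _ hij => by simpa using hij)
    simp at this
    omega
  · obtain ⟨w, hw, hwX, hxw⟩ := exists_reachable_rim hp hX (by simpa using hx)
    obtain ⟨w', hw', hwX', hyw'⟩ := exists_reachable_rim hp hX (by simpa using hy)
    exact (hxw.trans (reachableIn_compl_of_mem_rim (by omega) hX hw hw' hwX hwX')).trans hyw'.symm

end WindmillVertex

/-! ### The windmill is planar -/

/-- A drawing in which the interiors of the edges are given by injective curves that are disjoint
from each other and from the vertices is a plane embedding. -/
theorem PlaneEmbedding.nonempty_of_curves {V ι : Type*} {G : SimpleGraph V} (pt : V → Plane)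
    (src tgt : ι → V) (curve : ι → ℝ → Plane) (hcont : ∀ e, Continuous (curve e))
    (h0 : ∀ e, curve e 0 = pt (src e)) (h1 : ∀ e, curve e 1 = pt (tgt e))
    (hG : ∀ x y, G.Adj x y → ∃ e, s(src e, tgt e) = s(x, y)) (hpt : Function.Injective pt)
    (hvert : ∀ e t w, 0 < t → t < 1 → curve e t ≠ pt w)
    (hedge : ∀ e e' t t', 0 < t → t < 1 → 0 < t' → t' < 1 → curve e t = curve e' t' →
      e = e' ∧ t = t') : Nonempty (PlaneEmbedding G) := by
  have hG' : ∀ e : G.edgeSet, ∃ k, s(src k, tgt k) = (e : Sym2 V) := by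
    rintro ⟨⟨x, y⟩, hxy⟩
    exact hG x y hxy
  choose κ hκ using hG'
  have hne : ∀ e, src (κ e) ≠ tgt (κ e) := fun e h => by
    have := e.2
    rw [← hκ e, h, SimpleGraph.mem_edgeSet] at this
    exact G.irrefl this
  have hcases : ∀ k, ∀ t ∈ Set.Icc (0 : ℝ) 1, (t = 0 ∧ curve k t = pt (src k)) ∨
      (t = 1 ∧ curve k t = pt (tgt k)) ∨ (0 < t ∧ t < 1) := fun k t ht => by
    rcases ht.1.eq_or_lt with rfl | h
    · exact .inl ⟨rfl, h0 k⟩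
    · rcases ht.2.eq_or_lt with rfl | h'
      · exact .inr (.inl ⟨rfl, h1 k⟩)
      · exact .inr (.inr ⟨h, h'⟩)
  have hinj : ∀ e : G.edgeSet, Set.InjOn (curve (κ e)) (Set.Icc 0 1) := fun e t ht t' ht' htt' => by
    rcases hcases (κ e) t ht with ⟨rfl, h⟩ | ⟨rfl, h⟩ | h <;>
      rcases hcases (κ e) t' ht' with ⟨rfl, h'⟩ | ⟨rfl, h'⟩ | h'
    · rfl
    · exact (hne e (hpt (h.symm.trans (htt'.trans h')))).elim
    · exact (hvert _ _ _ h'.1 h'.2 (htt'.symm.trans h)).elim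
    · exact (hne e (hpt (h'.symm.trans (htt'.symm.trans h)))).elim
    · rfl
    · exact (hvert _ _ _ h'.1 h'.2 (htt'.symm.trans h)).elim
    · exact (hvert _ _ _ h.1 h.2 (htt'.trans h')).elim
    · exact (hvert _ _ _ h.1 h.2 (htt'.trans h')).elim
    · exact (hedge _ _ _ _ h.1 h.2 h'.1 h'.2 htt').2
  have hmem : ∀ (e : G.edgeSet) (t : ℝ) (w : V), t ∈ Set.Icc (0 : ℝ) 1 → curve (κ e) t = pt w →
      w ∈ (e : Sym2 V) := fun e t w ht h => by
    rw [← hκ e, Sym2.mem_iff]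
    rcases hcases (κ e) t ht with ⟨-, h'⟩ | ⟨-, h'⟩ | h'
    · exact .inl (hpt (h.symm.trans h'))
    · exact .inr (hpt (h.symm.trans h'))
    · exact (hvert _ _ _ h'.1 h'.2 h).elim
  refine ⟨{ point := pt, arc := fun e => curve (κ e) '' Set.Icc 0 1, point_injective := hpt,
            isArc := fun x y h => ?_, mem_of_point_mem := ?_, arc_inter := ?_ }⟩
  · have hrange : ∀ f : unitInterval → ℝ, Set.range f = Set.Icc 0 1 →
        Set.range (fun t => curve (κ ⟨s(x, y), h⟩) (f t)) =
          curve (κ ⟨s(x, y), h⟩) '' Set.Icc 0 1 := fun f hf => by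
      rw [← hf, ← Set.range_comp]; rfl
    rcases Sym2.eq_iff.1 (hκ ⟨s(x, y), h⟩) with ⟨hx, hy⟩ | ⟨hx, hy⟩
    · refine ⟨⟨⟨fun t => curve (κ ⟨s(x, y), h⟩) t, (hcont _).comp continuous_subtype_val⟩,
        by
          change curve _ ((0 : unitInterval) : ℝ) = _
          rw [Set.Icc.coe_zero, h0, hx], by
          change curve _ ((1 : unitInterval) : ℝ) = _
          rw [Set.Icc.coe_one, h1, hy]⟩, ?_, ?_⟩
      · intro t t' htt'
        exact Subtype.ext (hinj _ t.2 t'.2 htt')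
      · exact hrange _ Subtype.range_coe
    · refine ⟨⟨⟨fun t => curve (κ ⟨s(x, y), h⟩) (unitInterval.symm t),
        (hcont _).comp (continuous_subtype_val.comp unitInterval.continuous_symm)⟩,
        by
          change curve _ (unitInterval.symm 0 : ℝ) = _
          rw [unitInterval.symm_zero, Set.Icc.coe_one, h1, hy], by
          change curve _ (unitInterval.symm 1 : ℝ) = _
          rw [unitInterval.symm_one, Set.Icc.coe_zero, h0, hx]⟩, ?_, ?_⟩
      · intro t t' htt'
        exact unitInterval.symm_bijective.injective
          (Subtype.ext (hinj _ (unitInterval.symm t).2 (unitInterval.symm t').2 htt'))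
      · refine hrange (fun t => (unitInterval.symm t : ℝ)) ?_
        rw [← Subtype.range_coe (s := Set.Icc (0 : ℝ) 1)]
        exact unitInterval.symm_bijective.surjective.range_comp Subtype.val
  · rintro e w ⟨t, ht, h⟩
    exact hmem e t w ht h
  · rintro e e' hee' x ⟨⟨t, ht, rfl⟩, ⟨t', ht', hx⟩⟩
    have hκne : κ e ≠ κ e' := fun h => hee' (Subtype.ext (by rw [← hκ e, ← hκ e', h]))
    rcases hcases (κ e) t ht with ⟨-, h⟩ | ⟨-, h⟩ | h
    · exact ⟨_, hmem e t _ ht h, hmem e' t' _ ht' (hx.trans h), h⟩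
    · exact ⟨_, hmem e t _ ht h, hmem e' t' _ ht' (hx.trans h), h⟩
    · rcases hcases (κ e') t' ht' with ⟨-, h'⟩ | ⟨-, h'⟩ | h'
      · exact (hvert _ _ _ h.1 h.2 (hx.symm.trans h')).elim
      · exact (hvert _ _ _ h.1 h.2 (hx.symm.trans h')).elim
      · exact (hκne (hedge _ _ _ _ h.1 h.2 h'.1 h'.2 hx.symm).1).elim

/-- The point with polar coordinates `r` and `π * (2 * i + x) / p`. -/
noncomputable def polarPoint {p : ℕ} (i : Fin p) (x r : ℝ) : Plane :=
  !₂[r * Real.cos (Real.pi * (2 * i + x) / p), r * Real.sin (Real.pi * (2 * i + x) / p)]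

/-- Equal points have equal radii, and angles that differ by a multiple of 2π; both angles lie in
[0, 2π), so they agree, and the half-open sectors determine the index. -/
theorem polarPoint_inj {p : ℕ} {i i' : Fin p} {x x' r r' : ℝ} (hx : 0 ≤ x) (hx2 : x < 2)
    (hx' : 0 ≤ x') (hx2' : x' < 2) (hr : 0 < r) (hr' : 0 ≤ r')
    (h : polarPoint i x r = polarPoint i' x' r') : i = i' ∧ x = x' ∧ r = r' := by
  have hc : r * Real.cos (Real.pi * (2 * i + x) / p) =
      r' * Real.cos (Real.pi * (2 * i' + x') / p) := by
    simpa [polarPoint] using congrArg (fun v : Plane => v 0) h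
  have hs : r * Real.sin (Real.pi * (2 * i + x) / p) =
      r' * Real.sin (Real.pi * (2 * i' + x') / p) := by
    simpa [polarPoint] using congrArg (fun v : Plane => v 1) h
  set α := Real.pi * (2 * i + x) / p with hα
  set β := Real.pi * (2 * i' + x') / p with hβ
  have hrr : r = r' := by
    have h1 := Real.sin_sq_add_cos_sq α
    have h2 := Real.sin_sq_add_cos_sq β
    have h3 : r ^ 2 = r' ^ 2 := by
      calc r ^ 2 = (r * Real.sin α) ^ 2 + (r * Real.cos α) ^ 2 := by linear_combination -r ^ 2 * h1
        _ = r' ^ 2 := by rw [hs, hc]; linear_combination r' ^ 2 * h2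
    exact (sq_eq_sq₀ hr.le hr').1 h3
  subst hrr
  have hang := Real.Angle.cos_sin_inj (mul_left_cancel₀ hr.ne' hc) (mul_left_cancel₀ hr.ne' hs)
  obtain ⟨k, hk⟩ := Real.Angle.angle_eq_iff_two_pi_dvd_sub.1 hang
  have hp : (0 : ℝ) < p := by exact_mod_cast i.pos
  have hk' : (2 * (i : ℝ) + x) - (2 * i' + x') = 2 * p * k := by
    have hpi := Real.pi_pos
    rw [hα, hβ] at hk
    field_simp at hk
    linear_combination hk
  have hi : (i : ℝ) + 1 ≤ p := by exact_mod_cast i.2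
  have hi' : (i' : ℝ) + 1 ≤ p := by exact_mod_cast i'.2
  have hi0 : (0 : ℝ) ≤ (i : ℕ) := by positivity
  have hi0' : (0 : ℝ) ≤ (i' : ℕ) := by positivity
  have hk0 : k = 0 := by
    have h1 : (k : ℝ) < 1 := by nlinarith
    have h2 : (-1 : ℝ) < k := by nlinarith
    have h1' : k < 1 := by exact_mod_cast h1
    have h2' : -1 < k := by exact_mod_cast h2
    omega
  rw [hk0] at hk'
  simp only [Int.cast_zero, mul_zero] at hk'
  have h1 : (i : ℝ) < i' + 1 := by linarith
  have h2 : (i' : ℝ) < i + 1 := by linarith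
  have h1' : (i : ℕ) < i' + 1 := by exact_mod_cast h1
  have h2' : (i' : ℕ) < i + 1 := by exact_mod_cast h2
  have hii : i = i' := Fin.ext (by omega)
  subst hii
  exact ⟨rfl, by linarith, rfl⟩

theorem polarPoint_two {p : ℕ} (i : Fin p) (r : ℝ) :
    polarPoint i 2 r = polarPoint (finRotate p i) 0 r := by
  obtain ⟨n, rfl⟩ : ∃ n, p = n + 1 := ⟨p - 1, by have := i.pos; omega⟩
  have hp : ((n + 1 : ℕ) : ℝ) ≠ 0 := by positivity
  unfold polarPoint
  rw [coe_finRotate]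
  split_ifs with h
  · have : Real.pi * (2 * ((i : ℕ) : ℝ) + 2) / ((n + 1 : ℕ) : ℝ) = 0 + 2 * Real.pi := by
      rw [h, Fin.val_last]; field_simp; push_cast; ring
    rw [this, Real.cos_add_two_pi, Real.sin_add_two_pi]
    simp
  · push_cast
    ring_nf

theorem continuous_polarPoint {p : ℕ} (i : Fin p) {x r : ℝ → ℝ} (hx : Continuous x)
    (hr : Continuous r) : Continuous fun t => polarPoint i (x t) (r t) := by
  unfold polarPoint
  refine (PiLp.continuous_toLp 2 _).comp (continuous_pi fun k => ?_)
  fin_cases k <;> simp <;> fun_prop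

/-! ### The polar drawing of the windmill -/

namespace WindmillVertex

variable {p q : ℕ}

/-- The edges of the windmill as data, with the bounds on the rows stated for real numbers. -/
inductive Rail (p q : ℕ) : Type
  | uv (i : Fin p)
  | vu (i : Fin p)
  | zu (i : Fin p)
  | zv (i : Fin p)
  | ua (i : Fin p) (h : (2 : ℝ) ≤ 2 * q)
  | vb (i : Fin p) (h : (2 : ℝ) ≤ 2 * q)
  | uc (i : Fin p) (h : (2 : ℝ) ≤ 2 * q)
  | aa (i : Fin p) (j : ℕ) (h : (2 : ℝ) ≤ j) (h' : (j : ℝ) + 1 ≤ 2 * q)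
  | bb (i : Fin p) (j : ℕ) (h : (2 : ℝ) ≤ j) (h' : (j : ℝ) + 1 ≤ 2 * q)
  | cc (i : Fin p) (j : ℕ) (h : (2 : ℝ) ≤ j) (h' : (j : ℝ) + 1 ≤ 2 * q)
  | ab (i : Fin p) (j : ℕ) (h : (2 : ℝ) ≤ j) (h' : (j : ℝ) ≤ 2 * q)
  | bc (i : Fin p) (j : ℕ) (h : (2 : ℝ) ≤ j) (h' : (j : ℝ) ≤ 2 * q)
  | ac (i : Fin p) (h : (2 : ℝ) ≤ 2 * q)

namespace Rail

def src : Rail p q → WindmillVertex p q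
  | uv i => .u i
  | vu i => .v i
  | zu _ => .z
  | zv _ => .z
  | ua i _ => .u i
  | vb i _ => .v i
  | uc i _ => .u (finRotate p i)
  | aa i j _ _ => colA i j
  | bb i j _ _ => colB i j
  | cc i j _ _ => colC i j
  | ab i j _ _ => colA i j
  | bc i j _ _ => colB i j
  | ac i _ => colA i (2 * q)

def tgt : Rail p q → WindmillVertex p q
  | uv i => .v i
  | vu i => .u (finRotate p i)
  | zu i => .u i
  | zv i => .v i
  | ua i _ => colA i 2
  | vb i _ => colB i 2
  | uc i _ => colC i 2
  | aa i j _ _ => colA i (j + 1)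
  | bb i j _ _ => colB i (j + 1)
  | cc i j _ _ => colC i (j + 1)
  | ab i j _ _ => colB i j
  | bc i j _ _ => colC i j
  | ac i _ => colC i (2 * q)

/-- The vane that contains the edge. -/
def idx : Rail p q → Fin p
  | uv i | vu i | zu i | zv i | ua i _ | vb i _ | uc i _ | aa i _ _ _ | bb i _ _ _ | cc i _ _ _
  | ab i _ _ _ | bc i _ _ _ | ac i _ => i

/-- The angular coordinate along the edge. -/
noncomputable def ang : Rail p q → ℝ → ℝ
  | uv _, t => t
  | vu _, t => 1 + t
  | zu _, _ => 0
  | zv _, _ => 1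
  | ua _ _, t => t / 2
  | vb _ _, _ => 1
  | uc _ _, t => 2 - t / 2
  | aa _ _ _ _, _ => 1 / 2
  | bb _ _ _ _, _ => 1
  | cc _ _ _ _, _ => 3 / 2
  | ab _ _ _ _, t => 1 / 2 + t / 2
  | bc _ _ _ _, t => 1 + t / 2
  | ac _ _, t => 1 / 2 + t

/-- The radial coordinate along the edge. -/
noncomputable def rad : Rail p q → ℝ → ℝ
  | uv _, _ => 1
  | vu _, _ => 1
  | zu _, t => t
  | zv _, t => t
  | ua _ _, t => 1 + t
  | vb _ _, t => 1 + t / 2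
  | uc _ _, t => 1 + t
  | aa _ j _ _, t => j + t
  | bb _ j _ _, t => j - 1 / 2 + t
  | cc _ j _ _, t => j + t
  | ab _ j _ _, t => j - t / 2
  | bc _ j _ _, t => j - 1 / 2 + t / 2
  | ac _ _, _ => 2 * q

theorem continuous_ang (e : Rail p q) : Continuous e.ang := by
  cases e <;> unfold ang <;> fun_prop

theorem continuous_rad (e : Rail p q) : Continuous e.rad := by
  cases e <;> unfold rad <;> fun_prop

theorem bounds (e : Rail p q) {t : ℝ} (h0 : 0 < t) (h1 : t < 1) :
    0 ≤ e.ang t ∧ e.ang t < 2 ∧ 0 < e.rad t := by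
  cases e <;> simp only [ang, rad] <;> refine ⟨?_, ?_, ?_⟩ <;> linarith

/-- In the coordinates (angle, radius) of a sector every edge is a straight segment, so all
comparisons are linear. Within one family of edges the radii force the rows to differ by less than
one. -/
theorem eq_of_coords {e e' : Rail p q} {t t' : ℝ} (h0 : 0 < t) (h1 : t < 1) (h0' : 0 < t')
    (h1' : t' < 1) (hi : e.idx = e'.idx) (hx : e.ang t = e'.ang t') (hr : e.rad t = e'.rad t') :
    e = e' ∧ t = t' := by
  have hnat : ∀ {j j' : ℕ}, (j : ℝ) < j' + 1 → (j' : ℝ) < j + 1 → j = j' := fun h h' => by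
    have h1 := Nat.lt_succ_iff.1 (show _ < _ + 1 by exact_mod_cast h)
    have h2 := Nat.lt_succ_iff.1 (show _ < _ + 1 by exact_mod_cast h')
    omega
  cases e <;> cases e' <;> simp only [idx, ang, rad] at hi hx hr <;>
    first
    | (exfalso; linarith)
    | (subst hi; exact ⟨rfl, by linarith⟩)
    | (rename_i i j _ _ i' j' _ _
       obtain rfl : j = j' := hnat (by linarith) (by linarith)
       subst hi
       exact ⟨rfl, by linarith⟩)

end Rail

/-- The vane of a vertex. -/
def idx (hp : 0 < p) : WindmillVertex p q → Fin p
  | z => ⟨0, hp⟩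
  | u i | v i | a i _ | b i _ | c i _ => i

/-- The angular coordinate of a vertex. -/
noncomputable def ang : WindmillVertex p q → ℝ
  | z | u _ => 0
  | v _ | b _ _ => 1
  | a _ _ => 1 / 2
  | c _ _ => 3 / 2

/-- The radial coordinate of a vertex. -/
noncomputable def rad : WindmillVertex p q → ℝ
  | z => 0
  | u _ | v _ => 1
  | a _ j | c _ j => (j : ℕ)
  | b _ j => (j : ℕ) - 1 / 2

theorem two_le_cast (j : Set.Icc 2 (2 * q)) : (2 : ℝ) ≤ (j : ℕ) := by exact_mod_cast j.2.1

theorem cast_le_two_mul (j : Set.Icc 2 (2 * q)) : ((j : ℕ) : ℝ) ≤ 2 * q := by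
  exact_mod_cast j.2.2

theorem ang_bounds (w : WindmillVertex p q) : 0 ≤ w.ang ∧ w.ang < 2 := by
  cases w <;> norm_num [ang]

theorem rad_nonneg (w : WindmillVertex p q) : 0 ≤ w.rad := by
  cases w with
  | b i j => have := two_le_cast j; simp only [rad]; linarith
  | _ => simp [rad]

theorem coords_ne_rail {e : Rail p q} {t : ℝ} (h0 : 0 < t) (h1 : t < 1) (w : WindmillVertex p q)
    (hx : e.ang t = w.ang) (hr : e.rad t = w.rad) : False := by
  have hnat : ∀ {j j' : ℕ}, (j : ℝ) < j' → (j' : ℝ) < j + 1 → False := fun h h' => by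
    have h1 := Nat.lt_succ_iff.1 (show _ < _ + 1 by exact_mod_cast h')
    have h2 : _ < _ := Nat.cast_lt.1 h
    omega
  cases w with
  | a i j | b i j | c i j =>
    have := two_le_cast j
    have := cast_le_two_mul j
    cases e <;> simp only [Rail.ang, Rail.rad, ang, rad] at hx hr <;>
      first
      | linarith
      | (rename_i j' _ _
         exact hnat (j := j') (j' := j) (by linarith) (by linarith))
  | _ => cases e <;> simp only [Rail.ang, Rail.rad, ang, rad] at hx hr <;> linarith

/-- The position of a vertex in the plane. -/
noncomputable def position (hp : 0 < p) (w : WindmillVertex p q) : Plane :=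
  polarPoint (w.idx hp) w.ang w.rad

theorem position_injective (hp : 0 < p) :
    Function.Injective (position hp : WindmillVertex p q → Plane) := by
  have key : ∀ w w' : WindmillVertex p q, 0 < w.rad → position hp w = position hp w' → w = w' := by
    intro w w' hw h
    obtain ⟨hi, hx, hr⟩ := polarPoint_inj (ang_bounds w).1 (ang_bounds w).2 (ang_bounds w').1
      (ang_bounds w').2 hw (rad_nonneg w') h
    clear h
    cases w <;> cases w' <;> simp only [idx, ang, rad] at hi hx hr hw <;>
      first
      | (exfalso; linarith)
      | (subst hi; rfl)
      | (rename_i i j i' j'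
         have hj : ((j : ℕ) : ℝ) = (j' : ℕ) := by linarith
         obtain rfl : j = j' := Subtype.ext (by exact_mod_cast hj)
         subst hi
         rfl)
      | (rename_i j
         have := two_le_cast j
         linarith)
      | (rename_i j _
         have := two_le_cast j
         linarith)
  intro w w' h
  rcases (rad_nonneg w).eq_or_lt with hw | hw
  · rcases (rad_nonneg w').eq_or_lt with hw' | hw'
    · have hz : ∀ w : WindmillVertex p q, 0 = w.rad → w = z := fun w hw => by
        cases w with
        | z => rfl
        | u i | v i => simp [rad] at hw
        | a i j | b i j | c i j =>
          have := two_le_cast j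
          simp only [rad] at hw
          linarith
      rw [hz w hw, hz w' hw']
    · exact (key _ _ hw' h.symm).symm
  · exact key _ _ hw h

/-- Each vane fills one sector, with its paths at angles 1/2, 1 and 3/2 and the row as radius. The
second path is lowered by 1/2 so that the edge joining the outer ends, at constant radius 2q, passes
above b_{i,2q}. -/
theorem nonempty_planeEmbedding (hp : 0 < p) : Nonempty (PlaneEmbedding (windmillGraph p q)) := by
  have hz : ∀ (i : Fin p) (x : ℝ), polarPoint i x 0 = position hp (z : WindmillVertex p q) := fun i x => by
    simp [position, polarPoint, rad]
  have hA : ∀ (i : Fin p) (j : ℕ), (2 : ℝ) ≤ j → (j : ℝ) ≤ 2 * q →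
      polarPoint i (1 / 2) j = position hp (colA i j : WindmillVertex p q) := fun i j h h' => by
    rw [colA_of_mem ⟨by exact_mod_cast h, by exact_mod_cast h'⟩]; rfl
  have hB : ∀ (i : Fin p) (j : ℕ), (2 : ℝ) ≤ j → (j : ℝ) ≤ 2 * q →
      polarPoint i 1 (j - 1 / 2) = position hp (colB i j : WindmillVertex p q) := fun i j h h' => by
    rw [colB_of_mem ⟨by exact_mod_cast h, by exact_mod_cast h'⟩]; rfl
  have hC : ∀ (i : Fin p) (j : ℕ), (2 : ℝ) ≤ j → (j : ℝ) ≤ 2 * q →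
      polarPoint i (3 / 2) j = position hp (colC i j : WindmillVertex p q) := fun i j h h' => by
    rw [colC_of_mem ⟨by exact_mod_cast h, by exact_mod_cast h'⟩]; rfl
  refine PlaneEmbedding.nonempty_of_curves (position hp) Rail.src Rail.tgt
    (fun e t => polarPoint e.idx (e.ang t) (e.rad t))
    (fun e => continuous_polarPoint _ e.continuous_ang e.continuous_rad) (fun e => ?_) (fun e => ?_)
    (fun x y hxy => ?_) (position_injective hp) (fun e t w h0 h1 h => ?_)
    (fun e e' t t' h0 h1 h0' h1' h => ?_)
  · cases e <;> simp only [Rail.idx, Rail.ang, Rail.rad, Rail.src]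
    case uv i => rfl
    case vu i => rw [add_zero]; rfl
    case zu i => exact hz _ _
    case zv i => exact hz _ _
    case ua i _ => rw [zero_div, add_zero]; rfl
    case vb i _ => rw [zero_div, add_zero]; rfl
    case uc i _ => rw [zero_div, add_zero, sub_zero, polarPoint_two]; rfl
    case aa i j h h' => rw [add_zero]; exact hA _ _ h (by linarith)
    case bb i j h h' => rw [add_zero]; exact hB _ _ h (by linarith)
    case cc i j h h' => rw [add_zero]; exact hC _ _ h (by linarith)
    case ab i j h h' => rw [zero_div, sub_zero, add_zero]; exact hA _ _ h h'
    case bc i j h h' => rw [zero_div, add_zero, add_zero]; exact hB _ _ h h'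
    case ac i h =>
      rw [add_zero]
      exact_mod_cast hA i (2 * q) (by exact_mod_cast h) (by push_cast; rfl)
  · cases e <;> simp only [Rail.idx, Rail.ang, Rail.rad, Rail.tgt]
    case uv i => rfl
    case vu i => norm_num only; rw [polarPoint_two]; rfl
    case zu i => rfl
    case zv i => rfl
    case ua i h => rw [← hA i 2 (by norm_num) (by exact_mod_cast h)]; norm_num
    case vb i h => rw [← hB i 2 (by norm_num) (by exact_mod_cast h)]; norm_num
    case uc i h => rw [← hC i 2 (by norm_num) (by exact_mod_cast h)]; norm_num
    case aa i j h h' => rw [← hA i (j + 1) (by push_cast; linarith) (by push_cast; exact h')]; simp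
    case bb i j h h' =>
      rw [← hB i (j + 1) (by push_cast; linarith) (by push_cast; exact h')]
      congr 1; push_cast; ring
    case cc i j h h' => rw [← hC i (j + 1) (by push_cast; linarith) (by push_cast; exact h')]; simp
    case ab i j h h' => rw [← hB i j h h']; norm_num
    case bc i j h h' => rw [← hC i j h h']; congr 1 <;> ring
    case ac i h =>
      rw [← hC i (2 * q) (by exact_mod_cast h) (by push_cast; rfl)]
      congr 1 <;> norm_num
  · have key : ∀ x y : WindmillVertex p q, Step x y → ∃ e : Rail p q, e.src = x ∧ e.tgt = y := by
      intro x y h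
      cases h with
      | uv i => exact ⟨.uv i, rfl, rfl⟩
      | vu i => exact ⟨.vu i, rfl, rfl⟩
      | zu i => exact ⟨.zu i, rfl, rfl⟩
      | zv i => exact ⟨.zv i, rfl, rfl⟩
      | ua i h => exact ⟨.ua i (by exact_mod_cast h.2), rfl, colA_of_mem h⟩
      | vb i h => exact ⟨.vb i (by exact_mod_cast h.2), rfl, colB_of_mem h⟩
      | uc i h => exact ⟨.uc i (by exact_mod_cast h.2), rfl, colC_of_mem h⟩
      | aa i j h h' =>
        exact ⟨.aa i j (by exact_mod_cast h.1) (by exact_mod_cast h'.2), colA_of_mem h,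
          colA_of_mem h'⟩
      | bb i j h h' =>
        exact ⟨.bb i j (by exact_mod_cast h.1) (by exact_mod_cast h'.2), colB_of_mem h,
          colB_of_mem h'⟩
      | cc i j h h' =>
        exact ⟨.cc i j (by exact_mod_cast h.1) (by exact_mod_cast h'.2), colC_of_mem h,
          colC_of_mem h'⟩
      | ab i j =>
        exact ⟨.ab i j (two_le_cast j) (cast_le_two_mul j), colA_of_mem j.2, colB_of_mem j.2⟩
      | bc i j =>
        exact ⟨.bc i j (two_le_cast j) (cast_le_two_mul j), colB_of_mem j.2, colC_of_mem j.2⟩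
      | ac i j h =>
        obtain ⟨j, hj⟩ := j
        obtain rfl : j = 2 * q := h
        exact ⟨.ac i (by exact_mod_cast hj.1), colA_of_mem hj, colC_of_mem hj⟩
    rcases adj_iff.1 hxy with h | h
    · obtain ⟨e, rfl, rfl⟩ := key _ _ h
      exact ⟨e, rfl⟩
    · obtain ⟨e, rfl, rfl⟩ := key _ _ h
      exact ⟨e, Sym2.eq_swap⟩
  · have hb := e.bounds h0 h1
    obtain ⟨-, hx, hr⟩ := polarPoint_inj hb.1 hb.2.1 (ang_bounds w).1 (ang_bounds w).2 hb.2.2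
      (rad_nonneg w) h
    exact coords_ne_rail h0 h1 w hx hr
  · have hb := e.bounds h0 h1
    have hb' := e'.bounds h0' h1'
    obtain ⟨hi, hx, hr⟩ := polarPoint_inj hb.1 hb.2.1 hb'.1 hb'.2.1 hb.2.2 hb'.2.2.le h
    exact Rail.eq_of_coords h0 h1 h0' h1' hi hx hr

end WindmillVertex

/-- A rooted `K_{2,t}` minor contains a rooted `K_{2,s}` minor for every `s ≤ t`. -/
theorem HasRootedK2Minor.mono {V : Type*} {G : SimpleGraph V} {R : Set V} {s t : ℕ} (hst : s ≤ t)
    (h : HasRootedK2Minor G R t) : HasRootedK2Minor G R s := by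
  obtain ⟨M, hM, hR⟩ := h
  have hinj : Function.Injective (Sum.map (id : Fin 2 → Fin 2) (Fin.castLE hst)) :=
    Function.injective_id.sumMap (Fin.castLE_injective hst)
  refine ⟨M ∘ Sum.map id (Fin.castLE hst), ⟨fun w => hM.connected _,
    fun x y hxy => hM.disjoint _ _ (hinj.ne hxy), fun x y hxy => hM.edge _ _ ?_⟩,
    fun j => hR (Fin.castLE hst j)⟩
  rcases x with x | x <;> rcases y with y | y <;> simp_all

theorem mainTheorem4 :
    -- the windmill graphs
    (∀ t : ℕ, 6 ≤ t → Even t →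
      (windmill t).IsVertexConnected 3 ∧ Nonempty (PlaneEmbedding (windmill t)) ∧
        ¬ HasRootedK2Minor (windmill t) (windmillRoots t) t) ∧
    -- every face cover, in every plane embedding, has quadratic size
    (∃ c : ℝ, 0 < c ∧ ∀ t : ℕ, 6 ≤ t → Even t →
      ∀ (E : PlaneEmbedding (windmill t)) (C : Finset (Set Plane)),
        E.IsFaceCover (windmillRoots t) C → c * (t : ℝ) ^ 2 ≤ (C.card : ℝ)) ∧
    -- every valid bound on the size of a face cover is at least quadratic
    (∀ f : ℕ → ℕ,
      (∀ t : ℕ, 1 ≤ t → ∀ (V : Type) [Finite V] (G : SimpleGraph V) (R : Set V)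
        (E : PlaneEmbedding G), G.IsVertexConnected 3 → ¬ HasRootedK2Minor G R t →
          ∃ C : Finset (Set Plane), E.IsFaceCover R C ∧ C.card ≤ f t) →
      ∃ c : ℝ, 0 < c ∧ ∀ t : ℕ, 6 ≤ t → c * (t : ℝ) ^ 2 ≤ (f t : ℝ)) := by
  have h1 : ∀ t : ℕ, 6 ≤ t → Even t →
      (windmill t).IsVertexConnected 3 ∧ Nonempty (PlaneEmbedding (windmill t)) ∧
        ¬ HasRootedK2Minor (windmill t) (windmillRoots t) t := fun t ht hev =>
    ⟨WindmillVertex.windmillGraph_isVertexConnected (by omega),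
      WindmillVertex.nonempty_planeEmbedding (by omega), windmill_not_hasRootedK2Minor ht hev⟩
  refine ⟨h1, ⟨1 / 100, by norm_num, fun t ht hev E C hC => windmill_faceCover_card ht hev E C hC⟩,
    fun f hf => ⟨1 / 200, by norm_num, fun t ht => ?_⟩⟩
  -- For odd t the windmill of parameter t - 1 is used; having no minor for s, it has none for t ≥
  -- s. The constant is halved because (s + 1)² ≤ 2s² for s ≥ 6.
  obtain ⟨s, hs, hev, hst, hts⟩ : ∃ s, 6 ≤ s ∧ Even s ∧ s ≤ t ∧ t ≤ s + 1 := by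
    rcases Nat.even_or_odd t with h | ⟨k, rfl⟩
    · exact ⟨t, ht, h, le_rfl, by omega⟩
    · exact ⟨2 * k, by omega, even_two_mul k, by omega, le_rfl⟩
  obtain ⟨hconn, ⟨E⟩, hminor⟩ := h1 s hs hev
  obtain ⟨C, hC, hCf⟩ := hf t (by omega) _ _ (windmillRoots s) E hconn
    fun h => hminor (h.mono hst)
  have hcard := windmill_faceCover_card hs hev E C hC
  have hs' : (6 : ℝ) ≤ s := by exact_mod_cast hs
  have hts' : (t : ℝ) ≤ s + 1 := by exact_mod_cast hts
  calc (1 / 200 : ℝ) * (t : ℝ) ^ 2 ≤ 1 / 200 * ((s : ℝ) + 1) ^ 2 := by gcongr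
    _ ≤ 1 / 100 * (s : ℝ) ^ 2 := by nlinarith
    _ ≤ C.card := hcard
    _ ≤ f t := by exact_mod_cast hCf
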